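/- Let $\alpha\in\mathbb C$ and let $N\ge 0$ be an integer. Let $\mathbb A=\{Y=(Y_1,\dots,Y_N)\in(\mathbb R^3)^N : Y_j\ne Y_{j'} \text{ for } j\ne j'\}$ be the (open) set of admissible $N$-tuples. For $Y\in\mathbb A$ let $H_Y$ be the point interaction Hamiltonian in $L^2(\mathbb R^3)$ with centers $Y_1,\dots,Y_N$, all of strength parameter $\alpha$. Its resonances are, by definition, the zeros $k\in\mathbb C$ of the entire function $z\mapsto\det\Gamma_Y(z)$, counted with multiplicity, where $$\Gamma_Y(z)=\Big[\big(\alpha-\tfrac{iz}{4\pi}\big)\delta_{jj'}-\widetilde G_z(Y_j-Y_{j'})\Big]_{j,j'=1}^N,\qquad \widetilde G_z(x)=\frac{e^{iz|x|}}{4\pi|x|}\ (x\ne0),\quad \widetilde G_z(0)=0 .$$ Let $\mathcal N_{H_Y}(R)$ be the number of resonances $k$ with $|k|\le R$, counted with multiplicity, let $\mathrm{Ad}(H_Y)=\lim_{R\to\infty}\mathcal N_{H_Y}(R)/R$, and let $V(Y)=\max_{\sigma\in S_N}\sum_{j=1}^N|Y_j-Y_{\sigma(j)}|$. For every $Y\in\mathbb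 A$ this limit exists and $\mathrm{Ad}(H_Y)\le V(Y)/\pi$. Let $$\mathbb A_0=\{Y\in\mathbb A : \mathrm{Ad}(H_Y)<V(Y)/\pi\}$$ be the set of admissible $N$-tuples with non-Weyl-type asymptotics. Then: (i) $\mathbb A_0$ is contained in a proper real-analytic subset of $\mathbb A$, i.e. there is a real-analytic function $f:\mathbb A\to\mathbb R$, not identically zero, with $\mathbb A_0\subseteq\{Y\in\mathbb A: f(Y)=0\}$; (ii) $\mathbb A_0$ has Lebesgue measure zero in $(\mathbb R^3)^N=\mathbb R^{3N}$. -/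

import Mathlib

open Filter Topology MeasureTheory

namespace PointInteraction

/-- The space `ℝ³` with its Euclidean norm. -/
abbrev E3 : Type := EuclideanSpace ℝ (Fin 3)

/-- The set of admissible `N`-tuples `Y ∈ (ℝ³)^N`: the centers `Y_1, …, Y_N` are pairwise distinct.
The measure `volume` on `Fin N → E3` is the product of the Lebesgue measures on `ℝ³`, that is,
`3N`-dimensional Lebesgue measure. -/
def admissible (N : ℕ) : Set (Fin N → E3) :=
  {Y | ∀ j j' : Fin N, j ≠ j' → Y j ≠ Y j'}

/-- The kernel `G̃_z(x) = exp(i z |x|) / (4 π |x|)` for `x ≠ 0`, and `G̃_z(0) = 0`. -/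
noncomputable def greenTilde (z : ℂ) (x : E3) : ℂ :=
  open Classical in
  if x = 0 then 0
  else Complex.exp (Complex.I * z * (‖x‖ : ℂ)) / (4 * (Real.pi : ℂ) * (‖x‖ : ℂ))

/-- The matrix `Γ_Y(z) = [(α - i z / (4π)) δ_{jj'} - G̃_z(Y_j - Y_{j'})]_{j,j'}` that enters the
resolvent formula of the point interaction Hamiltonian `H_Y` with strength parameter `α`. -/
noncomputable def gammaMatrix (α : ℂ) {N : ℕ} (Y : Fin N → E3) (z : ℂ) :
    Matrix (Fin N) (Fin N) ℂ :=
  Matrix.of fun j j' =>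
    (α - Complex.I * z / (4 * (Real.pi : ℂ))) * (if j = j' then 1 else 0)
      - greenTilde z (Y j - Y j')

/-- The characteristic determinant `det Γ_Y(·)`, an entire function. -/
noncomputable def charDet (α : ℂ) {N : ℕ} (Y : Fin N → E3) (z : ℂ) : ℂ :=
  (gammaMatrix α Y z).det

/-- The set of resonances of `H_Y`: the zeros of the characteristic determinant. -/
def resonances (α : ℂ) {N : ℕ} (Y : Fin N → E3) : Set ℂ :=
  {k | charDet α Y k = 0}

/-- The multiplicity of a resonance: its order as a zero of the characteristic determinant. -/
noncomputable def resonanceMult (α : ℂ) {N : ℕ} (Y : Fin N → E3) (k : ℂ) : ℕ :=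
  analyticOrderNatAt (charDet α Y) k

/-- The counting function `R ↦ #{k ∈ Σ(H_Y) : |k| ≤ R}`, with multiplicities. For admissible `Y`
the entire function `charDet α Y` is not identically zero, so this is a finite sum. -/
noncomputable def resonanceCount (α : ℂ) {N : ℕ} (Y : Fin N → E3) (R : ℝ) : ℕ :=
  ∑ᶠ k ∈ {k : ℂ | k ∈ resonances α Y ∧ ‖k‖ ≤ R}, resonanceMult α Y k

/-- The total asymptotic density of resonances, `Ad(H_Y) = lim_{R → ∞} #{|k| ≤ R} / R`. -/
noncomputable def asymptoticDensity (α : ℂ) {N : ℕ} (Y : Fin N → E3) : ℝ :=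
  limUnder atTop (fun R : ℝ => (resonanceCount α Y R : ℝ) / R)

/-- The size `V(Y) = max_{σ ∈ S_N} ∑_j |Y_j - Y_{σ(j)}|`. -/
noncomputable def size {N : ℕ} (Y : Fin N → E3) : ℝ :=
  (Finset.univ : Finset (Equiv.Perm (Fin N))).sup' Finset.univ_nonempty
    (fun σ => ∑ j, ‖Y j - Y (σ j)‖)

/-- The admissible tuples with non-Weyl-type asymptotics of resonances: `Ad(H_Y) < V(Y) / π`. -/
def nonWeylSet (α : ℂ) (N : ℕ) : Set (Fin N → E3) :=
  {Y | Y ∈ admissible N ∧ asymptoticDensity α Y < size Y / Real.pi}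

/-- `S` is a proper (real-)analytic subset of the open set `O`: the zero set in `O` of one
real-analytic function on `O` that does not vanish identically on `O`. -/
def IsProperAnalyticSubset {E : Type*} [NormedAddCommGroup E] [NormedSpace ℝ E]
    (S O : Set E) : Prop :=
  IsOpen O ∧ ∃ f : E → ℝ, AnalyticOnNhd ℝ f O ∧ (∃ x ∈ O, f x ≠ 0) ∧ S = {x | x ∈ O ∧ f x = 0}

end PointInteraction

open PointInteraction

/-!
The Leibniz expansion writes `det Γ_Y(z)` as a sum over permutations `σ` of
`permCoeff α Y σ (z) * exp (i z V_σ(Y))`, with polynomial coefficients and with the frequencies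
`V_σ(Y) = ∑ j, |Y_j - Y_{σ(j)}|` (`permLength`). For an admissible `Y` the frequency `0` comes from
the identity alone, so its coefficient is nonzero. Let `b` be the largest frequency whose total
coefficient is nonzero; clearly `b ≤ V(Y)`.

*Density of zeros.* An exponential polynomial `F` with extreme frequencies `0` and `b` satisfies
`log ‖F z‖ ≈ b max(0, -Im z)` away from the real axis, so its mean over the circle of radius `R`
should be `b R / π + o(R)`. The only difficulty is the part of the circle near the real axis, where
`log ‖F‖` may be very negative; there the Poisson–Jensen inequality
(`AnalyticOnNhd.log_norm_le_circleAverage_poissonKernel`), applied at two points of the upper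
half-plane close to `R` and `-R`, bounds the loss by an arbitrarily small multiple of `R`
(`le_circleAverage_log_norm`). Jensen's formula turns the circle mean into the logarithmic counting
function of the zeros, and a Tauberian argument (`tendsto_div_of_log_increments`) gives the density
`b / π` of the zeros themselves. Hence the limit exists and equals `b / π ≤ V(Y) / π`.

*Generic equality.* The inequality is strict only if the coefficient of the frequency `V(Y)`
vanishes. Permutations that differ by the reversal of cycles (`SameEdges`) have equal frequencies for
all `Y`, but also equal coefficients, sign included, so they do not cancel. Cancellation thus forces
`V_σ(Y) = V_τ(Y)` for some `σ`, `τ` with different edges, that is, `discriminant N Y = 0`. The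
discriminant is a finite product of analytic functions `V_σ - V_τ`, none of which vanishes
identically near any admissible tuple: as a function of the position `y` of one center, it could be
continued analytically to all `y`, and it fails to be differentiable where that center meets a
suitable other one (`frequently_weighted_distances_ne_zero`). The zero set of an analytic function of
this kind is Lebesgue null (`measure_zeros_eq_zero_of_analyticOnNhd`), which yields both the measure
statement and a point where the discriminant is nonzero.
-/

/-! ### The Poisson–Jensen inequality -/

open Metric Real MeromorphicOn in
/-- The Poisson integral of `log ‖· - u‖` over a circle around `0` dominates `log ‖w - u‖`; for `u`
inside the circle, `log ‖· - u‖` agrees on the circle with the harmonic function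
`log (‖R² - ū ·‖ / R)`, which is at least as large at `w`. -/
theorem log_norm_sub_le_circleAverage_poissonKernel {R : ℝ} {w u : ℂ} (hw : w ∈ ball (0 : ℂ) R)
    (hu : u ∈ closedBall (0 : ℂ) R) (hwu : w ≠ u) :
    log ‖w - u‖ ≤ circleAverage (poissonKernel 0 w * (log ‖· - u‖)) 0 R := by
  have hR : 0 < R := pos_of_mem_ball hw
  by_cases hs : u ∈ sphere (0 : ℂ) R
  · rw [poissonKernel_eq_re_herglotzRieszKernel, circleAverage_re_herglotzRieszKernel_mul_log hs hw]
  have hw' : ‖w‖ < R := by simpa using hw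
  have hu' : ‖u‖ < R := by
    have h1 : ‖u‖ ≤ R := by simpa using hu
    have h2 : ‖u‖ ≠ R := by simpa using hs
    exact lt_of_le_of_ne h1 h2
  let g : ℂ → ℂ := fun z ↦ ((R : ℂ) ^ 2 - (starRingEnd ℂ) u * z) / R
  have hRC : (R : ℂ) ≠ 0 := by exact_mod_cast hR.ne'
  have key (z : ℂ) : ‖(R : ℂ) ^ 2 - (starRingEnd ℂ) u * z‖ ^ 2
      = R ^ 2 * ‖z - u‖ ^ 2 + (R ^ 2 - ‖u‖ ^ 2) * (R ^ 2 - ‖z‖ ^ 2) := by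
    simp only [← Complex.normSq_eq_norm_sq, Complex.normSq_apply]
    simp [pow_two]
    ring
  have gn (z : ℂ) : ‖g z‖ = ‖(R : ℂ) ^ 2 - (starRingEnd ℂ) u * z‖ / R := by
    simp [g, abs_of_pos hR]
  have g_sphere : ∀ z ∈ sphere (0 : ℂ) |R|, ‖g z‖ = ‖z - u‖ := by
    intro z hz
    have hz' : ‖z‖ = R := by simpa [abs_of_pos hR] using hz
    have := key z
    rw [hz', sub_self, mul_zero, add_zero, ← mul_pow] at this
    have h2 := (sq_eq_sq₀ (norm_nonneg _) (by positivity)).1 this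
    rw [gn, h2]; field_simp
  have g_ball : ‖w - u‖ ≤ ‖g w‖ := by
    rw [gn, le_div_iff₀ hR]
    refine (sq_le_sq₀ (by positivity) (norm_nonneg _)).1 ?_
    rw [key w]
    have h1 : 0 ≤ R ^ 2 - ‖u‖ ^ 2 := by nlinarith [norm_nonneg u]
    have h2 : 0 ≤ R ^ 2 - ‖w‖ ^ 2 := by nlinarith [norm_nonneg w]
    nlinarith [mul_nonneg h1 h2]
  have g_ne : ∀ z ∈ closedBall (0 : ℂ) R, g z ≠ 0 := by
    intro z hz h0
    have hz' : ‖z‖ ≤ R := by simpa using hz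
    have h3 : (R : ℂ) ^ 2 - (starRingEnd ℂ) u * z = 0 := by
      simpa [g, hRC] using h0
    have h4 : R ^ 2 = ‖u‖ * ‖z‖ := by
      have := congrArg norm (sub_eq_zero.1 h3)
      simpa [abs_of_pos hR] using this
    nlinarith [norm_nonneg u, norm_nonneg z]
  have g_an : ∀ z, AnalyticAt ℂ g z := fun z ↦ by
    have : Differentiable ℂ g := by fun_prop
    exact this.analyticAt z
  have harm : InnerProductSpace.HarmonicOnNhd (fun z ↦ log ‖g z‖) (closedBall 0 R) :=
    fun z hz ↦ (g_an z).harmonicAt_log_norm (g_ne z hz)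
  have h1 := harm.circleAverage_poissonKernel_smul hw
  rw [circleAverage_congr_sphere (f₂ := poissonKernel 0 w * (log ‖· - u‖))] at h1
  · rw [h1]
    exact log_le_log (norm_pos_iff.2 (sub_ne_zero.2 hwu)) g_ball
  · intro z hz
    simp only [Pi.smul_apply', Pi.mul_apply, smul_eq_mul, g_sphere z hz]

theorem continuousOn_poissonKernel_sphere {R : ℝ} {w : ℂ} (hw : w ∈ Metric.ball (0 : ℂ) R) :
    ContinuousOn (poissonKernel 0 w) (Metric.sphere 0 |R|) := by
  rw [poissonKernel_eq_re_herglotzRieszKernel]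
  exact Complex.continuous_re.comp_continuousOn (continuousOn_herglotzRieszKernel_sphere hw)

theorem CircleIntegrable.poissonKernel_mul {R : ℝ} {w : ℂ} {f : ℂ → ℝ}
    (hf : CircleIntegrable f 0 R) (hw : w ∈ Metric.ball (0 : ℂ) R) :
    CircleIntegrable (poissonKernel 0 w * f) 0 R := by
  refine IntervalIntegrable.continuousOn_mul hf ?_
  refine (continuousOn_poissonKernel_sphere hw).comp (by fun_prop) ?_
  intro θ _
  exact circleMap_mem_sphere' 0 R θ

open Metric Real MeromorphicOn in
/-- The **Poisson–Jensen inequality**, that is, the sub-mean value property of `log ‖f‖` with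
respect to the Poisson kernel. -/
theorem AnalyticOnNhd.log_norm_le_circleAverage_poissonKernel {R : ℝ} {w : ℂ} {f : ℂ → ℂ}
    (hf : AnalyticOnNhd ℂ f (closedBall 0 R)) (hw : w ∈ ball (0 : ℂ) R) (hfw : f w ≠ 0) :
    Real.log ‖f w‖ ≤ circleAverage (poissonKernel 0 w * (Real.log ‖f ·‖)) 0 R := by
  have hR : 0 < R := pos_of_mem_ball hw
  have hwc : w ∈ closedBall (0 : ℂ) R := ball_subset_closedBall hw
  have hm : MeromorphicOn f (closedBall 0 R) := hf.meromorphicOn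
  set D := divisor f (closedBall (0 : ℂ) R) with hD
  have hfin := D.finiteSupport (isCompact_closedBall 0 R)
  have hord : ∀ u : closedBall (0 : ℂ) R, meromorphicOrderAt f u ≠ ⊤ := by
    rw [← hm.exists_meromorphicOrderAt_ne_top_iff_forall
      ⟨nonempty_closedBall.mpr hR.le, (convex_closedBall 0 R).isPreconnected⟩]
    refine ⟨⟨w, hwc⟩, ?_⟩
    rw [(hf w hwc).meromorphicOrderAt_eq, (hf w hwc).analyticOrderAt_eq_zero.2 hfw]
    simp
  obtain ⟨g, h₁g, h₂g, h₃g⟩ := hm.extract_zeros_poles hord hfin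
  have hDw : D w = 0 := by
    rw [hD, hf.divisor_apply hwc, (hf w hwc).analyticOrderAt_eq_zero.2 hfw]; rfl
  have hval : Real.log ‖f w‖ = ∑ᶠ u, D u * Real.log ‖w - u‖ + Real.log ‖g w‖ := by
    have hacc : AccPt w (𝓟 (closedBall (0 : ℂ) R)) := by
      apply accPt_iff_frequently_nhdsNE.mpr
      apply compl_notMem
      apply mem_nhdsWithin.mpr
      exact ⟨ball 0 R, isOpen_ball, hw, fun z hz ↦ by
        simpa using (ball_subset_closedBall hz.1 : z ∈ closedBall (0 : ℂ) R)⟩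
    have := log_norm_meromorphicTrailingCoeffAt_extract_zeros_poles hfin hwc hacc
      (hm w hwc) (h₁g w hwc) (h₂g ⟨w, hwc⟩) h₃g
    rwa [(hf w hwc).meromorphicTrailingCoeffAt_of_ne_zero hfw] at this
  have hsupp : ∀ F : ℂ → ℝ, (∑ᶠ u, (D u : ℝ) * F u) = ∑ u ∈ hfin.toFinset, D u * F u := by
    intro F
    apply finsum_eq_sum_of_support_subset
    intro u hu
    simp only [Function.mem_support, ne_eq, mul_eq_zero, not_or, Int.cast_eq_zero] at hu
    simpa using hu.1
  have hsupp' : (∑ᶠ u, (fun z ↦ (D u : ℝ) * Real.log ‖z - u‖))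
      = ∑ u ∈ hfin.toFinset, (fun z ↦ (D u : ℝ) * Real.log ‖z - u‖) := by
    apply finsum_eq_sum_of_support_subset
    intro u hu
    have : D u ≠ 0 := by
      rintro h
      apply hu
      ext z
      simp [h]
    simpa using this
  have hlog := extract_zeros_poles_log h₂g h₃g
  have hgint : CircleIntegrable (Real.log ‖g ·‖) 0 R := by
    apply MeromorphicOn.circleIntegrable_log_norm
    rw [abs_of_pos hR]
    exact (h₁g.mono sphere_subset_closedBall).meromorphicOn
  have havg : circleAverage (poissonKernel 0 w * (Real.log ‖f ·‖)) 0 R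
      = ∑ u ∈ hfin.toFinset, D u * circleAverage (poissonKernel 0 w * (Real.log ‖· - u‖)) 0 R
        + Real.log ‖g w‖ := by
    have hcongr : poissonKernel 0 w * (Real.log ‖f ·‖) =ᶠ[codiscreteWithin (sphere 0 |R|)]
        (∑ u ∈ hfin.toFinset, (D u : ℝ) • (poissonKernel 0 w * (Real.log ‖· - u‖)))
          + poissonKernel 0 w * (Real.log ‖g ·‖) := by
      rw [abs_of_pos hR]
      filter_upwards [codiscreteWithin_mono sphere_subset_closedBall hlog] with z hz
      have h5 : (∑ᶠ u, (fun z ↦ (D u : ℝ) * Real.log ‖z - u‖)) z =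
          ∑ u ∈ hfin.toFinset, D u * Real.log ‖z - u‖ := by
        rw [hsupp', Finset.sum_apply]
      simp only [Pi.mul_apply, Pi.add_apply, Finset.sum_apply, Pi.smul_apply, smul_eq_mul]
      rw [hz, Pi.add_apply, h5, mul_add, Finset.mul_sum]
      congr 1
      exact Finset.sum_congr rfl fun u _ ↦ by ring
    have hint : ∀ u, CircleIntegrable ((D u : ℝ) • (poissonKernel 0 w * (Real.log ‖· - u‖))) 0 R :=
      fun u ↦ ((circleIntegrable_log_norm_sub_const R).poissonKernel_mul hw).const_smul
    rw [circleAverage_congr_codiscreteWithin hcongr hR.ne', circleAverage_add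
      (CircleIntegrable.sum _ fun u _ ↦ hint u) (hgint.poissonKernel_mul hw),
      circleAverage_sum fun u _ ↦ hint u]
    congr 1
    · exact Finset.sum_congr rfl fun u _ ↦ by rw [circleAverage_smul, smul_eq_mul]
    · have harm : InnerProductSpace.HarmonicOnNhd (fun z ↦ Real.log ‖g z‖) (closedBall 0 R) :=
        fun z hz ↦ (h₁g z hz).harmonicAt_log_norm (h₂g ⟨z, hz⟩)
      exact harm.circleAverage_poissonKernel_smul hw
  rw [hval, havg, hsupp]
  gcongr with u hu
  · have : (0 : ℤ) ≤ D u := hf.divisor_nonneg u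
    exact_mod_cast this
  · have hDu : D u ≠ 0 := by simpa using hu
    refine log_norm_sub_le_circleAverage_poissonKernel hw (D.supportWithinDomain hDu) ?_
    rintro rfl
    exact hDu hDw

/-! ### Circle means of `log ‖F‖` for functions of exponential growth -/

theorem circleAverage_max_zero_neg_im {R : ℝ} (hR : 0 ≤ R) :
    Real.circleAverage (fun z : ℂ ↦ max 0 (-z.im)) 0 R = R / Real.pi := by
  have hπ := Real.pi_pos
  have him (θ : ℝ) : (circleMap 0 R θ).im = R * Real.sin θ := by
    simp [circleMap, Complex.exp_ofReal_mul_I_im]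
  have hcont : Continuous fun θ : ℝ ↦ max 0 (-(R * Real.sin θ)) := by fun_prop
  have h1 : ∫ θ in (0)..Real.pi, max 0 (-(R * Real.sin θ)) = 0 := by
    rw [intervalIntegral.integral_congr (g := fun _ ↦ (0 : ℝ))]
    · simp
    · intro θ hθ
      rw [Set.uIcc_of_le hπ.le] at hθ
      have := mul_nonneg hR (Real.sin_nonneg_of_nonneg_of_le_pi hθ.1 hθ.2)
      simp only
      exact max_eq_left (by linarith)
  have h2 : ∫ θ in Real.pi..(2 * Real.pi), max 0 (-(R * Real.sin θ)) = 2 * R := by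
    rw [intervalIntegral.integral_congr (g := fun θ ↦ -(R * Real.sin θ))]
    · rw [intervalIntegral.integral_neg, intervalIntegral.integral_const_mul, integral_sin]
      simp; ring
    · intro θ hθ
      rw [Set.uIcc_of_le (by linarith)] at hθ
      have h3 : 0 ≤ Real.sin (θ - Real.pi) :=
        Real.sin_nonneg_of_nonneg_of_le_pi (by linarith [hθ.1]) (by linarith [hθ.2])
      rw [Real.sin_sub_pi] at h3
      simp only
      exact max_eq_right (by nlinarith)
  rw [Real.circleAverage_def]
  simp only [him]
  rw [← intervalIntegral.integral_add_adjacent_intervals (b := Real.pi)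
    (hcont.intervalIntegrable _ _) (hcont.intervalIntegrable _ _), h1, h2]
  simp only [smul_eq_mul]
  field_simp
  ring

theorem poissonKernel_nonneg {R : ℝ} {w z : ℂ} (hw : w ∈ Metric.ball (0 : ℂ) R)
    (hz : z ∈ Metric.sphere (0 : ℂ) |R|) : 0 ≤ poissonKernel 0 w z := by
  have hR : 0 < R := Metric.pos_of_mem_ball hw
  have h1 : ‖z‖ = R := by simpa [abs_of_pos hR] using hz
  have h2 : ‖w‖ < R := by simpa using hw
  rw [poissonKernel_def]
  simp only [sub_zero, h1]
  have : 0 ≤ R ^ 2 - ‖w‖ ^ 2 := by nlinarith [norm_nonneg w]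
  positivity

/-- A point of the upper half-plane near `e R`, with `e = 1` or `e = -1`, at distance comparable to
`s² R` from the circle of radius `R`. Its Poisson kernel is at least `1` on the arc `|Im z| ≤ s² R`
around `e R`. -/
noncomputable def nearAxisPoint (e s R : ℝ) : ℂ := ⟨e * (1 - s ^ 2) * R, s ^ 2 * R⟩

section NearAxis

variable {e s R : ℝ}

theorem norm_sq_nearAxisPoint (he : e ^ 2 = 1) :
    ‖nearAxisPoint e s R‖ ^ 2 = ((1 - s ^ 2) ^ 2 + s ^ 4) * R ^ 2 := by
  rw [← Complex.normSq_eq_norm_sq, Complex.normSq_apply]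
  simp only [nearAxisPoint]
  linear_combination (1 - s ^ 2) ^ 2 * R ^ 2 * he

theorem nearAxisPoint_mem_ball (he : e ^ 2 = 1) (hs : 0 < s) (hs5 : s ^ 2 ≤ 1 / 5) (hR : 0 < R) :
    nearAxisPoint e s R ∈ Metric.ball (0 : ℂ) R := by
  rw [mem_ball_zero_iff]
  have h := norm_sq_nearAxisPoint (s := s) (R := R) he
  have h1 : 0 < s ^ 2 := by positivity
  have h2 : (1 - s ^ 2) ^ 2 + s ^ 4 < 1 := by nlinarith
  have h3 : 0 < R ^ 2 := by positivity
  refine (sq_lt_sq₀ (norm_nonneg _) hR.le).1 ?_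
  rw [h]
  nlinarith

theorem one_le_poissonKernel_nearAxisPoint (he : e ^ 2 = 1) (hs : 0 < s) (hs5 : s ^ 2 ≤ 1 / 5)
    (hR : 0 < R) {z : ℂ} (hz : z ∈ Metric.sphere (0 : ℂ) |R|) (hre : 0 ≤ e * z.re)
    (him : |z.im| ≤ s ^ 2 * R) : 1 ≤ poissonKernel 0 (nearAxisPoint e s R) z := by
  have hzR : ‖z‖ = R := by simpa [abs_of_pos hR] using hz
  have hz2 : z.re ^ 2 + z.im ^ 2 = R ^ 2 := by
    rw [← hzR, ← Complex.normSq_eq_norm_sq, Complex.normSq_apply]; ring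
  have hball := nearAxisPoint_mem_ball he hs hs5 hR
  have hne : z - nearAxisPoint e s R ≠ 0 := by
    intro h
    rw [sub_eq_zero] at h
    rw [← h, mem_ball_zero_iff, hzR] at hball
    exact lt_irrefl _ hball
  rw [poissonKernel_def]
  simp only [sub_zero]
  rw [le_div_iff₀ (by positivity), one_mul, norm_sq_nearAxisPoint he, hzR,
    ← Complex.normSq_eq_norm_sq, Complex.normSq_apply]
  simp only [nearAxisPoint, Complex.sub_re, Complex.sub_im]
  set x := e * z.re with hx
  set y := z.im with hy
  set d := s ^ 2 with hd
  have hd0 : 0 < d := by positivity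
  have hx2 : x ^ 2 + y ^ 2 = R ^ 2 := by
    rw [← hz2, hx]; linear_combination z.re ^ 2 * he
  have hd4 : s ^ 4 = d ^ 2 := by rw [hd]; ring
  have hy2 : y ^ 2 ≤ d ^ 2 * R ^ 2 := by
    rw [← sq_abs]
    calc |y| ^ 2 ≤ (d * R) ^ 2 := by gcongr
      _ = _ := by ring
  have hxlow : (1 - d ^ 2) * R ≤ x := by
    have h0 : 0 ≤ 1 - d ^ 2 := by nlinarith
    refine (sq_le_sq₀ (by positivity) hre).1 ?_
    have : (1 - d ^ 2) ^ 2 * R ^ 2 ≤ (1 - d ^ 2) * R ^ 2 := by gcongr; nlinarith [sq_nonneg d]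
    nlinarith
  have hy' := (abs_le.1 him).1
  have hsplit : (z.re - e * (1 - d) * R) * (z.re - e * (1 - d) * R)
      + (y - d * R) * (y - d * R) = R ^ 2 + ((1 - d) ^ 2 + d ^ 2) * R ^ 2 - 2 * (1 - d) * R * x
        - 2 * d * R * y := by
    rw [hx]
    linear_combination hz2 + ((1 - d) ^ 2 * R ^ 2) * he
  rw [hsplit, hd4]
  have h1 : (1 - d) * R * ((1 - d ^ 2) * R) ≤ (1 - d) * R * x := by
    have : 0 ≤ 1 - d := by linarith
    gcongr
  have h2 : d * R * (-(d * R)) ≤ d * R * y := by gcongr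
  have h3 : 0 < R ^ 2 := by positivity
  have h4 : 2 * ((1 - d) ^ 2 + d ^ 2) - 2 * (1 - d) * (1 - d ^ 2) + 2 * d ^ 2 ≤ 0 := by
    nlinarith [mul_pos hd0 hd0]
  nlinarith [mul_le_mul_of_nonneg_right h4 h3.le]

/-- On the circle, `|Im z| ≤ (s R + ‖z - e R‖² / (s R)) / 2`, and `‖z - e R‖²` agrees there with the
harmonic function `2 R² - 2 e R Re z`. -/
theorem circleAverage_poissonKernel_nearAxisPoint_le (he : e ^ 2 = 1) (hs : 0 < s)
    (hs5 : s ^ 2 ≤ 1 / 5) (hR : 0 < R) :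
    Real.circleAverage (poissonKernel 0 (nearAxisPoint e s R) * (fun z : ℂ ↦ max 0 (-z.im))) 0 R
      ≤ 3 / 2 * s * R := by
  have hball := nearAxisPoint_mem_ball he hs hs5 hR
  let g : ℂ → ℂ := fun z ↦ (s * R / 2 + R / s : ℝ) - (e / s : ℝ) * z
  have harm : InnerProductSpace.HarmonicOnNhd (fun z ↦ (g z).re) (Metric.closedBall 0 R) := by
    intro z _
    have : Differentiable ℂ g := by fun_prop
    exact (this.analyticAt z).harmonicAt_re
  have h1 := harm.circleAverage_poissonKernel_smul hball
  have h2 : (g (nearAxisPoint e s R)).re = 3 / 2 * s * R := by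
    simp [g, nearAxisPoint]
    field_simp
    linear_combination (2 * s ^ 2 - 2) * he
  rw [h2] at h1
  rw [← h1]
  apply Real.circleAverage_mono
  · apply CircleIntegrable.poissonKernel_mul _ hball
    exact (by fun_prop : Continuous fun z : ℂ ↦ max 0 (-z.im)).continuousOn.circleIntegrable'
  · apply CircleIntegrable.poissonKernel_mul _ hball
    exact (by fun_prop : Continuous fun z : ℂ ↦ (g z).re).continuousOn.circleIntegrable'
  · intro z hz
    have hzR : ‖z‖ = R := by simpa [abs_of_pos hR] using hz
    have hz2 : z.re ^ 2 + z.im ^ 2 = R ^ 2 := by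
      rw [← hzR, ← Complex.normSq_eq_norm_sq, Complex.normSq_apply]; ring
    simp only [Pi.mul_apply, Pi.smul_apply', smul_eq_mul]
    refine mul_le_mul_of_nonneg_left ?_ (poissonKernel_nonneg hball hz)
    have hgz : (g z).re = s * R / 2 + R / s - e / s * z.re := by simp [g]
    rw [hgz]
    have h3 : z.im ^ 2 ≤ 2 * R ^ 2 - 2 * e * R * z.re := by
      nlinarith [sq_nonneg (z.re - e * R)]
    have h4 : s * R / 2 + R / s - e / s * z.re
        = (s ^ 2 * R ^ 2 + (2 * R ^ 2 - 2 * e * R * z.re)) / (2 * s * R) := by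
      field_simp
      ring
    rw [h4, le_div_iff₀ (by positivity)]
    rcases max_cases 0 (-z.im) with ⟨h, _⟩ | ⟨h, _⟩ <;> rw [h]
    · nlinarith
    · nlinarith [sq_nonneg (s * R + z.im)]

end NearAxis

section Growth

variable {F : ℂ → ℂ} {b C c : ℝ} {n : ℕ}

/-- A lower bound for `log ‖F‖` on average over a circle. Near the real axis, where zeros of `F` may
lie on the circle, the deficit of `log ‖F‖` from its upper bound is controlled by the Poisson–Jensen
inequality at the two points `nearAxisPoint 1 s R` and `nearAxisPoint (-1) s R`. -/
theorem le_circleAverage_log_norm (hF : Differentiable ℂ F) (hb : 0 ≤ b) (hC : 1 ≤ C)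
    (hU : ∀ z, ‖F z‖ ≤ C * (1 + ‖z‖) ^ n * Real.exp (b * max 0 (-z.im))) (hc : 0 < c)
    {s R : ℝ} (hs : 0 < s) (hs5 : s ^ 2 ≤ 1 / 5) (hR : 0 < R)
    (hL : ∀ z : ℂ, ‖z‖ = R → s ^ 2 * R ≤ |z.im| → c * Real.exp (b * max 0 (-z.im)) ≤ ‖F z‖)
    (hw : ∀ e : ℝ, e ^ 2 = 1 → c ≤ ‖F (nearAxisPoint e s R)‖) :
    b * (R / Real.pi) - (3 * b * s * R + 3 * |Real.log c|
      + 2 * (Real.log C + n * Real.log (1 + R))) ≤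
      Real.circleAverage (fun z ↦ Real.log ‖F z‖) 0 R := by
  set m := Real.log C + n * Real.log (1 + R) with hm
  have hm0 : 0 ≤ m := by
    have h1 := Real.log_nonneg hC
    have h2 := Real.log_nonneg (by linarith : 1 ≤ 1 + R)
    positivity
  set u : ℂ → ℝ := fun z ↦ Real.log ‖F z‖ with hu
  set h : ℂ → ℝ := fun z ↦ max 0 (-z.im) with hh
  have hh0 (z : ℂ) : 0 ≤ h z := le_max_left _ _
  have hnorm : ∀ z ∈ Metric.sphere (0 : ℂ) |R|, ‖z‖ = R := fun z hz ↦ by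
    simpa [abs_of_pos hR] using hz
  have hupper : ∀ z ∈ Metric.sphere (0 : ℂ) |R|, 0 ≤ m + b * h z - u z := by
    intro z hz
    have hzR := hnorm z hz
    -- at zeros of `F` the junk value `log 0 = 0` satisfies the bound as well
    by_cases h0 : F z = 0
    · have : u z = 0 := by simp [hu, h0]
      rw [this]
      have := mul_nonneg hb (hh0 z)
      linarith
    · have h1 := Real.log_le_log (norm_pos_iff.2 h0) (hU z)
      rw [hzR, Real.log_mul (by positivity) (by positivity), Real.log_mul (by positivity)
        (by positivity), Real.log_exp, Real.log_pow] at h1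
      simp only [hu, hh, hm]
      linarith
  have hui : CircleIntegrable u 0 R := by
    apply MeromorphicOn.circleIntegrable_log_norm
    intro z _
    exact (hF.analyticAt z).meromorphicAt
  have hhi : CircleIntegrable h 0 R :=
    (by fun_prop : Continuous fun z : ℂ ↦ max 0 (-z.im)).continuousOn.circleIntegrable'
  have hci (a : ℝ) : CircleIntegrable (fun _ : ℂ ↦ a) 0 R := circleIntegrable_const _ _ _
  have hvi : CircleIntegrable (fun z ↦ m + b * h z - u z) 0 R :=
    ((hci m).add (hhi.const_smul (a := b))).sub hui
  -- the Poisson integral of the deficit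
  have hdef : ∀ e : ℝ, e ^ 2 = 1 → Real.circleAverage
      (poissonKernel 0 (nearAxisPoint e s R) * (fun z ↦ m + b * h z - u z)) 0 R
        ≤ m + b * (3 / 2 * s * R) + |Real.log c| := by
    intro e he
    have hball := nearAxisPoint_mem_ball he hs hs5 hR
    have hFw : F (nearAxisPoint e s R) ≠ 0 := norm_pos_iff.1 (hc.trans_le (hw e he))
    have h1 := AnalyticOnNhd.log_norm_le_circleAverage_poissonKernel
      (fun z _ ↦ hF.analyticAt z) hball hFw
    have h2 : -|Real.log c| ≤ Real.log ‖F (nearAxisPoint e s R)‖ :=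
      (neg_abs_le _).trans (Real.log_le_log hc (hw e he))
    have h3 := circleAverage_poissonKernel_nearAxisPoint_le he hs hs5 hR
    have h4 : Real.circleAverage (poissonKernel 0 (nearAxisPoint e s R) * (fun _ ↦ m)) 0 R = m := by
      have harm : InnerProductSpace.HarmonicOnNhd (fun _ : ℂ ↦ m) (Metric.closedBall 0 R) :=
        fun z _ ↦ InnerProductSpace.harmonicAt_const m
      exact harm.circleAverage_poissonKernel_smul hball
    have h5 : poissonKernel 0 (nearAxisPoint e s R) * (fun z ↦ m + b * h z - u z)
        = poissonKernel 0 (nearAxisPoint e s R) * (fun _ ↦ m)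
          + b • (poissonKernel 0 (nearAxisPoint e s R) * h)
          - poissonKernel 0 (nearAxisPoint e s R) * u := by
      ext z
      simp only [Pi.mul_apply, Pi.add_apply, Pi.sub_apply, Pi.smul_apply, smul_eq_mul]
      ring
    rw [h5, Real.circleAverage_sub (((hci m).poissonKernel_mul hball).add
      ((hhi.poissonKernel_mul hball).const_smul)) (hui.poissonKernel_mul hball),
      Real.circleAverage_add ((hci m).poissonKernel_mul hball)
      ((hhi.poissonKernel_mul hball).const_smul), h4, Real.circleAverage_smul, smul_eq_mul]
    have h6 := mul_le_mul_of_nonneg_left h3 hb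
    linarith
  have hb1 := nearAxisPoint_mem_ball (one_pow 2) hs hs5 hR
  have hb2 := nearAxisPoint_mem_ball (by norm_num : (-1 : ℝ) ^ 2 = 1) hs hs5 hR
  set P₁ := poissonKernel 0 (nearAxisPoint 1 s R)
  set P₂ := poissonKernel 0 (nearAxisPoint (-1) s R)
  have hlow : ∀ z ∈ Metric.sphere (0 : ℂ) |R|,
      (b • h - (fun _ ↦ |Real.log c|) - P₁ * (fun z ↦ m + b * h z - u z)
        - P₂ * (fun z ↦ m + b * h z - u z) : ℂ → ℝ) z ≤ u z := by
    intro z hz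
    have hv := hupper z hz
    have hp1 : 0 ≤ P₁ z := poissonKernel_nonneg hb1 hz
    have hp2 : 0 ≤ P₂ z := poissonKernel_nonneg hb2 hz
    simp only [Pi.sub_apply, Pi.smul_apply, Pi.mul_apply, smul_eq_mul]
    rcases le_total (s ^ 2 * R) |z.im| with him | him
    · have h1 := Real.log_le_log (by positivity) (hL z (hnorm z hz) him)
      rw [Real.log_mul hc.ne' (by positivity), Real.log_exp] at h1
      have h2 := neg_abs_le (Real.log c)
      have h3 := mul_nonneg hp1 hv
      have h4 := mul_nonneg hp2 hv
      simp only [hu, hh] at *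
      linarith
    · have h1 : 1 ≤ P₁ z + P₂ z := by
        rcases le_total 0 z.re with hre | hre
        · have := one_le_poissonKernel_nearAxisPoint (one_pow 2) hs hs5 hR hz (by simpa) him
          linarith
        · have := one_le_poissonKernel_nearAxisPoint (by norm_num : (-1 : ℝ) ^ 2 = 1) hs hs5 hR hz
            (by simpa) him
          linarith
      have h2 := mul_le_mul_of_nonneg_right h1 hv
      have h3 := abs_nonneg (Real.log c)
      linarith
  have hI1 := hvi.poissonKernel_mul hb1
  have hI2 := hvi.poissonKernel_mul hb2
  have hI0 : CircleIntegrable (b • h - (fun _ ↦ |Real.log c|)) 0 R :=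
    (hhi.const_smul).sub (hci _)
  have hmono := Real.circleAverage_mono ((hI0.sub hI1).sub hI2) hui hlow
  rw [Real.circleAverage_sub (hI0.sub hI1) hI2, Real.circleAverage_sub hI0 hI1,
    Real.circleAverage_sub hhi.const_smul (hci _), Real.circleAverage_smul,
    Real.circleAverage_const, circleAverage_max_zero_neg_im hR.le, smul_eq_mul] at hmono
  have hd1 := hdef 1 (one_pow 2)
  have hd2 := hdef (-1) (by norm_num)
  linarith

theorem circleAverage_log_norm_le (hF : Differentiable ℂ F) (hb : 0 ≤ b) (hC : 1 ≤ C)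
    (hU : ∀ z, ‖F z‖ ≤ C * (1 + ‖z‖) ^ n * Real.exp (b * max 0 (-z.im))) {R : ℝ} (hR : 0 < R) :
    Real.circleAverage (fun z ↦ Real.log ‖F z‖) 0 R ≤
      b * (R / Real.pi) + (Real.log C + n * Real.log (1 + R)) := by
  set m := Real.log C + n * Real.log (1 + R) with hm
  have hm0 : 0 ≤ m := by
    have h1 := Real.log_nonneg hC
    have h2 := Real.log_nonneg (by linarith : 1 ≤ 1 + R)
    positivity
  have hui : CircleIntegrable (fun z ↦ Real.log ‖F z‖) 0 R := by
    apply MeromorphicOn.circleIntegrable_log_norm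
    intro z _
    exact (hF.analyticAt z).meromorphicAt
  have hhi : CircleIntegrable (fun z : ℂ ↦ max 0 (-z.im)) 0 R :=
    (by fun_prop : Continuous fun z : ℂ ↦ max 0 (-z.im)).continuousOn.circleIntegrable'
  have hci : CircleIntegrable (fun _ : ℂ ↦ m) 0 R := circleIntegrable_const _ _ _
  have hmono := Real.circleAverage_mono hui ((hhi.const_smul (a := b)).add hci) (by
    intro z hz
    have hzR : ‖z‖ = R := by simpa [abs_of_pos hR] using hz
    simp only [Pi.add_apply, Pi.smul_apply, smul_eq_mul]
    by_cases h0 : F z = 0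
    · rw [h0, norm_zero, Real.log_zero]
      have := mul_nonneg hb (le_max_left 0 (-z.im))
      linarith
    · have h1 := Real.log_le_log (norm_pos_iff.2 h0) (hU z)
      rw [hzR, Real.log_mul (by positivity) (by positivity), Real.log_mul (by positivity)
        (by positivity), Real.log_exp, Real.log_pow] at h1
      linarith)
  rwa [Real.circleAverage_add hhi.const_smul hci, Real.circleAverage_smul,
    Real.circleAverage_const, circleAverage_max_zero_neg_im hR.le, smul_eq_mul] at hmono

/-- Suppose that `‖F z‖` is at most `exp (b max(0, -Im z))` times a polynomial factor everywhere, and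
at least a constant multiple of `exp (b max(0, -Im z))` in every double sector away from the real
axis. Then the mean of `log ‖F‖` over the circle of radius `R` is asymptotic to `b R / π`. -/
theorem tendsto_circleAverage_log_norm_div (hF : Differentiable ℂ F) (hb : 0 ≤ b) (hC : 1 ≤ C)
    (hU : ∀ z, ‖F z‖ ≤ C * (1 + ‖z‖) ^ n * Real.exp (b * max 0 (-z.im))) (hc : 0 < c)
    (hL : ∀ s > 0, ∀ᶠ R : ℝ in atTop, ∀ z : ℂ, ‖z‖ = R → s * R ≤ |z.im| →
      c * Real.exp (b * max 0 (-z.im)) ≤ ‖F z‖) :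
    Tendsto (fun R ↦ Real.circleAverage (fun z ↦ Real.log ‖F z‖) 0 R / R) atTop
      (𝓝 (b / Real.pi)) := by
  have hlog : Tendsto (fun R : ℝ ↦ Real.log (1 + R) / R) atTop (𝓝 0) := by
    have h1 : Tendsto (fun x : ℝ ↦ Real.log x / x) atTop (𝓝 0) := by
      simpa using (Real.isLittleO_log_id_atTop).tendsto_div_nhds_zero
    have h2 := h1.comp (tendsto_atTop_add_const_left atTop (1 : ℝ) tendsto_id)
    have h3 : Tendsto (fun R : ℝ ↦ (1 + R) / R) atTop (𝓝 1) := by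
      have : Tendsto (fun R : ℝ ↦ R⁻¹ + 1) atTop (𝓝 (0 + 1)) :=
        tendsto_inv_atTop_zero.add_const 1
      rw [zero_add] at this
      refine this.congr' ?_
      filter_upwards [eventually_gt_atTop 0] with R hR
      field_simp
    have h4 := h2.mul h3
    rw [zero_mul] at h4
    refine h4.congr' ?_
    filter_upwards [eventually_gt_atTop 0] with R hR
    have : (1 + R) ≠ 0 := by positivity
    simp only [Function.comp, id]
    field_simp
  have hrest (A B : ℝ) : Tendsto (fun R : ℝ ↦ (A + B * Real.log (1 + R)) / R) atTop (𝓝 0) := by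
    have h1 : Tendsto (fun R : ℝ ↦ A * R⁻¹ + B * (Real.log (1 + R) / R)) atTop
        (𝓝 (A * 0 + B * 0)) := (tendsto_inv_atTop_zero.const_mul A).add (hlog.const_mul B)
    rw [mul_zero, mul_zero, add_zero] at h1
    refine h1.congr fun R ↦ ?_
    ring
  rw [tendsto_order]
  constructor
  · intro a ha
    -- the loss `3 b s` caused by the arcs near the real axis is arbitrarily small
    obtain ⟨s, hs, hs5, hsa⟩ : ∃ s : ℝ, 0 < s ∧ s ^ 2 ≤ 1 / 5 ∧ a < b / Real.pi - 3 * b * s := by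
      have h1 : Tendsto (fun s : ℝ ↦ b / Real.pi - 3 * b * s) (𝓝[>] 0)
          (𝓝 (b / Real.pi - 3 * b * 0)) :=
        (by fun_prop : Continuous fun s : ℝ ↦ b / Real.pi - 3 * b * s).continuousAt.tendsto.mono_left
          nhdsWithin_le_nhds
      rw [mul_zero, sub_zero] at h1
      have h2 : Tendsto (fun s : ℝ ↦ s ^ 2) (𝓝[>] 0) (𝓝 (0 ^ 2)) :=
        (continuous_pow 2).continuousAt.tendsto.mono_left nhdsWithin_le_nhds
      have h3 := h2.eventually_le_const (by norm_num : (0 : ℝ) ^ 2 < 1 / 5)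
      obtain ⟨s, hs1, hs2, hs3⟩ :=
        ((h1.eventually_const_lt ha).and (h3.and self_mem_nhdsWithin)).exists
      exact ⟨s, hs3, hs2, hs1⟩
    -- both points `nearAxisPoint e s R` lie on the circle of radius `κ R`
    set κ : ℝ := √((1 - s ^ 2) ^ 2 + s ^ 4) with hκ
    have hκ0 : 0 < κ := by
      apply Real.sqrt_pos.2
      have : 0 < s ^ 4 := by positivity
      positivity
    have hκ1 : κ ≤ 1 := by
      apply Real.sqrt_le_one.2
      nlinarith [sq_nonneg s]
    have hs2 : 0 < s ^ 2 := by positivity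
    have hκev : ∀ᶠ R : ℝ in atTop, ∀ z : ℂ, ‖z‖ = κ * R → s ^ 2 * (κ * R) ≤ |z.im| →
        c * Real.exp (b * max 0 (-z.im)) ≤ ‖F z‖ :=
      (tendsto_id.const_mul_atTop hκ0).eventually (hL (s ^ 2) hs2)
    have hr := (hrest (3 * |Real.log c| + 2 * Real.log C) (2 * n)).eventually_lt_const
      (sub_pos.2 hsa)
    filter_upwards [hL (s ^ 2) hs2, hκev, hr, eventually_gt_atTop 0] with R h1 h2 h3 hR
    have hw : ∀ e : ℝ, e ^ 2 = 1 → c ≤ ‖F (nearAxisPoint e s R)‖ := by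
      intro e he
      have him : (nearAxisPoint e s R).im = s ^ 2 * R := rfl
      have hn : ‖nearAxisPoint e s R‖ = κ * R := by
        refine (sq_eq_sq₀ (norm_nonneg _) (by positivity)).1 ?_
        rw [norm_sq_nearAxisPoint he, mul_pow, hκ, Real.sq_sqrt (by positivity)]
      have h4 := h2 _ hn (by
        rw [him, abs_of_nonneg (by positivity)]
        gcongr
        nlinarith)
      rwa [him, max_eq_left (by nlinarith), mul_zero, Real.exp_zero, mul_one] at h4
    have h5 := le_circleAverage_log_norm hF hb hC hU hc hs hs5 hR h1 hw
    rw [lt_div_iff₀ hR]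
    rw [div_lt_iff₀ hR] at h3
    have h6 : b * (R / Real.pi) = b / Real.pi * R := by ring
    rw [h6] at h5
    linarith
  · intro a ha
    have hr := (hrest (Real.log C) n).eventually_lt_const (sub_pos.2 ha)
    filter_upwards [hr, eventually_gt_atTop 0] with R h3 hR
    have h5 := circleAverage_log_norm_le hF hb hC hU hR
    rw [div_lt_iff₀ hR] at h3 ⊢
    have h6 : b * (R / Real.pi) = b / Real.pi * R := by ring
    rw [h6] at h5
    linarith

end Growth

/-! ### From circle means to the counting function of zeros -/

/-- A Tauberian argument: if `N` has increments comparable to those of `∫ n(t) dt / t` and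
`N R / R → c`, then `n R / R → c`. -/
theorem tendsto_div_of_log_increments {n N : ℝ → ℝ} {c : ℝ}
    (hlow : ∀ R > 0, ∀ l > 1, n R * Real.log l ≤ N (l * R) - N R)
    (hupp : ∀ R > 0, ∀ l > 1, N (l * R) - N R ≤ n (l * R) * Real.log l)
    (hc : 0 ≤ c) (hN : Tendsto (fun R ↦ N R / R) atTop (𝓝 c)) :
    Tendsto (fun R ↦ n R / R) atTop (𝓝 c) := by
  have hscale (l : ℝ) (hl : 0 < l) : Tendsto (fun R ↦ N (l * R) / R) atTop (𝓝 (l * c)) := by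
    have h1 := (hN.comp (tendsto_id.const_mul_atTop hl)).const_mul l
    refine h1.congr' ?_
    filter_upwards [eventually_gt_atTop 0] with R hR
    simp only [Function.comp, id]
    field_simp
  rw [tendsto_order]
  constructor
  · intro a ha
    -- `(1 - l⁻¹) / log l ≥ l⁻¹`, which tends to `1` as `l → 1`
    obtain ⟨l, hl, hla⟩ : ∃ l : ℝ, 1 < l ∧ a < l⁻¹ * c := by
      have h1 : Tendsto (fun l : ℝ ↦ l⁻¹ * c) (𝓝[>] 1) (𝓝 (1⁻¹ * c)) :=
        ((tendsto_inv₀ one_ne_zero).mul_const c).mono_left nhdsWithin_le_nhds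
      rw [inv_one, one_mul] at h1
      obtain ⟨l, h2, h3⟩ := ((h1.eventually_const_lt ha).and self_mem_nhdsWithin).exists
      exact ⟨l, h3, h2⟩
    have hl0 : 0 < l := by linarith
    have hlog : 0 < Real.log l := Real.log_pos hl
    have h1 := hN.sub (hscale l⁻¹ (inv_pos.2 hl0))
    have h2 : a * Real.log l < c - l⁻¹ * c := by
      have h3 : Real.log l ≤ l - 1 := Real.log_le_sub_one_of_pos hl0
      have h4 : c - l⁻¹ * c = l⁻¹ * c * (l - 1) := by field_simp
      rw [h4]
      calc a * Real.log l < l⁻¹ * c * Real.log l := by gcongr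
        _ ≤ _ := by gcongr
    filter_upwards [h1.eventually_const_lt h2, eventually_gt_atTop 0] with R hR hR0
    have h5 := hupp (l⁻¹ * R) (by positivity) l hl
    rw [mul_inv_cancel_left₀ hl0.ne'] at h5
    rw [← sub_div, lt_div_iff₀ hR0] at hR
    rw [lt_div_iff₀ hR0]
    have : a * R * Real.log l < n R * Real.log l := by linarith
    exact lt_of_mul_lt_mul_right this hlog.le
  · intro a ha
    -- `(l - 1) / log l ≤ l`, which tends to `1` as `l → 1`
    obtain ⟨l, hl, hla⟩ : ∃ l : ℝ, 1 < l ∧ l * c < a := by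
      have h1 : Tendsto (fun l : ℝ ↦ l * c) (𝓝[>] 1) (𝓝 (1 * c)) :=
        (tendsto_id.mul_const c).mono_left nhdsWithin_le_nhds
      rw [one_mul] at h1
      obtain ⟨l, h2, h3⟩ := ((h1.eventually_lt_const ha).and self_mem_nhdsWithin).exists
      exact ⟨l, h3, h2⟩
    have hl0 : 0 < l := by linarith
    have hlog : 0 < Real.log l := Real.log_pos hl
    have h1 := (hscale l hl0).sub hN
    have h2 : l * c - c < a * Real.log l := by
      have h3 : 1 - l⁻¹ ≤ Real.log l := Real.one_sub_inv_le_log_of_pos hl0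
      have h4 : l * c - c = l * c * (1 - l⁻¹) := by field_simp
      rw [h4]
      calc l * c * (1 - l⁻¹) ≤ l * c * Real.log l := by gcongr
        _ < _ := by gcongr
    filter_upwards [h1.eventually_lt_const h2, eventually_gt_atTop 0] with R hR hR0
    have h5 := hlow R hR0 l hl
    rw [← sub_div, div_lt_iff₀ hR0] at hR
    rw [div_lt_iff₀ hR0]
    have : n R * Real.log l < a * R * Real.log l := by linarith
    exact lt_of_mul_lt_mul_right this hlog.le

/-- The number of zeros of `F` in the closed disc of radius `R`, counted with multiplicity. -/
noncomputable def zeroCount (F : ℂ → ℂ) (R : ℝ) : ℕ :=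
  ∑ᶠ k ∈ {k : ℂ | F k = 0 ∧ ‖k‖ ≤ R}, analyticOrderNatAt F k

section Counting

open Function.locallyFinsuppWithin MeromorphicOn

variable {F : ℂ → ℂ}

theorem divisor_univ_apply_eq_analyticOrderNatAt (hF : Differentiable ℂ F) (z : ℂ) :
    divisor F Set.univ z = analyticOrderNatAt F z := by
  rw [AnalyticOnNhd.divisor_apply (fun z _ ↦ hF.analyticAt z) (Set.mem_univ z),
    analyticOrderNatAt]
  cases analyticOrderAt F z <;> simp

theorem finite_zeros_closedBall (F : ℂ → ℂ) (r : ℝ) :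
    {u : ℂ | divisor F Set.univ u ≠ 0 ∧ ‖u‖ ≤ r}.Finite := by
  have h := (toClosedBall r (divisor F Set.univ)).finiteSupport (isCompact_closedBall 0 |r|)
  refine h.subset fun u hu ↦ ?_
  rw [Function.mem_support, toClosedBall_eval_within]
  · exact hu.1
  · simpa using hu.2.trans (le_abs_self r)

theorem zeroCount_eq_sum (hF : Differentiable ℂ F) {r r' : ℝ} (hr : r ≤ r') :
    (zeroCount F r : ℝ) = ∑ u ∈ (finite_zeros_closedBall F r').toFinset,
      divisor F Set.univ u * (if ‖u‖ ≤ r then (1 : ℝ) else 0) := by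
  classical
  have h1 : zeroCount F r = ∑ u ∈ (finite_zeros_closedBall F r').toFinset with ‖u‖ ≤ r,
      analyticOrderNatAt F u := by
    unfold zeroCount
    apply finsum_mem_eq_sum_of_inter_support_eq
    ext u
    simp only [Set.mem_inter_iff, Set.mem_ofPred_eq, Function.mem_support, Finset.coe_filter,
      Set.Finite.mem_toFinset, divisor_univ_apply_eq_analyticOrderNatAt hF]
    constructor
    · rintro ⟨⟨h1, h2⟩, h3⟩
      exact ⟨⟨⟨by exact_mod_cast h3, h2.trans hr⟩, h2⟩, h3⟩
    · rintro ⟨⟨⟨h1, h2⟩, h4⟩, h3⟩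
      exact ⟨⟨apply_eq_zero_of_analyticOrderNatAt_ne_zero h3, h4⟩, h3⟩
  rw [h1, Finset.sum_filter]
  push_cast
  refine Finset.sum_congr rfl fun u _ ↦ ?_
  rw [divisor_univ_apply_eq_analyticOrderNatAt hF]
  split_ifs <;> simp

/-- The logarithmic counting function as a sum over a finite set that does not depend on `r ≤ r'`, so
that its values at two radii can be compared term by term. -/
theorem logCounting_eq_sum (F : ℂ → ℂ) {r r' : ℝ} (hr0 : 0 < r)
    (hr : r ≤ r') :
    logCounting (divisor F Set.univ) r = ∑ u ∈ (finite_zeros_closedBall F r').toFinset,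
      divisor F Set.univ u * (if u = 0 then Real.log r else Real.posLog (r * ‖u‖⁻¹)) := by
  classical
  set D := divisor F Set.univ with hD
  have h1 (u : ℂ) : toClosedBall r D u * Real.log (r * ‖u‖⁻¹)
      = D u * (if u = 0 then 0 else Real.posLog (r * ‖u‖⁻¹)) := by
    split_ifs with h0
    · simp [h0]
    have hu : 0 < ‖u‖ := norm_pos_iff.2 h0
    by_cases hur : ‖u‖ ≤ r
    · rw [toClosedBall_eval_within _ (by simpa using hur.trans (le_abs_self r)),
        Real.posLog_eq_log]
      rw [abs_of_pos (by positivity), ← div_eq_mul_inv, le_div_iff₀ hu]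
      linarith
    · rw [apply_eq_zero_of_notMem (toClosedBall r D) (by simpa [abs_of_pos hr0] using hur),
        (Real.posLog_eq_zero_iff _).2]
      · simp
      · rw [abs_of_pos (by positivity), ← div_eq_mul_inv, div_le_one hu]
        exact (not_le.1 hur).le
  have h2 : logCounting D r = ∑ᶠ u, (toClosedBall r D u : ℝ) * Real.log (r * ‖u‖⁻¹)
      + D 0 * Real.log r := rfl
  rw [h2, finsum_congr h1, finsum_eq_sum_of_support_subset
    (s := (finite_zeros_closedBall F r').toFinset)]
  · have h3 : (D 0 : ℝ) * Real.log r = ∑ u ∈ (finite_zeros_closedBall F r').toFinset,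
        (if u = 0 then D u * Real.log r else 0) := by
      rw [Finset.sum_ite_eq']
      split_ifs with h
      · rfl
      · have : D 0 = 0 := by
          by_contra h4
          exact h (by simpa [← hD] using ⟨h4, hr0.le.trans hr⟩)
        simp [this]
    rw [h3, ← Finset.sum_add_distrib]
    refine Finset.sum_congr rfl fun u _ ↦ ?_
    split_ifs <;> simp [hD]
  · intro u hu
    rw [Function.mem_support, ← h1] at hu
    have h4 : toClosedBall r D u ≠ 0 := fun h ↦ hu (by simp [h])
    have h5 := (toClosedBall r D).supportWithinDomain h4
    rw [toClosedBall_eval_within _ h5] at h4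
    have h6 : ‖u‖ ≤ r := by simpa [abs_of_pos hr0] using h5
    simpa [← hD] using ⟨h4, h6.trans hr⟩

theorem posLog_mul_sub_posLog_le {x l : ℝ} (hl : 1 < l) :
    Real.posLog (l * x) - Real.posLog x ≤ Real.log l := by
  have h1 := Real.posLog_mul (x := l) (y := x)
  rw [Real.posLog_eq_log (x := l) (by rw [abs_of_pos] <;> linarith)] at h1
  linarith

theorem logCounting_increment_bounds (hF : Differentiable ℂ F) {R l : ℝ} (hR : 0 < R) (hl : 1 < l) :
    zeroCount F R * Real.log l ≤
        logCounting (divisor F Set.univ) (l * R) - logCounting (divisor F Set.univ) R ∧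
      logCounting (divisor F Set.univ) (l * R) - logCounting (divisor F Set.univ) R ≤
        zeroCount F (l * R) * Real.log l := by
  have hRl : R ≤ l * R := by nlinarith
  have hl0 : 0 < l := by linarith
  have hlog := Real.log_pos hl
  have hD (u : ℂ) : (0 : ℝ) ≤ divisor F Set.univ u := by
    rw [divisor_univ_apply_eq_analyticOrderNatAt hF]; positivity
  rw [zeroCount_eq_sum hF hRl, zeroCount_eq_sum hF (le_refl (l * R)),
    logCounting_eq_sum F (by positivity) (le_refl (l * R)), logCounting_eq_sum F hR hRl,
    ← Finset.sum_sub_distrib, Finset.sum_mul, Finset.sum_mul]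
  constructor
  · refine Finset.sum_le_sum fun u hu ↦ ?_
    rw [← mul_sub, mul_assoc (divisor F Set.univ u : ℝ)]
    refine mul_le_mul_of_nonneg_left ?_ (hD u)
    by_cases h0 : u = 0
    · simp [h0, hR.le, Real.log_mul hl0.ne' hR.ne']
    have hun : 0 < ‖u‖ := norm_pos_iff.2 h0
    simp only [h0, if_false]
    split_ifs with h
    · have h1 : 1 ≤ R * ‖u‖⁻¹ := by
        rw [← div_eq_mul_inv, le_div_iff₀ hun]; linarith
      have h2 : 1 ≤ l * R * ‖u‖⁻¹ := by rw [mul_assoc]; nlinarith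
      rw [Real.posLog_eq_log (by rwa [abs_of_pos (by linarith)]),
        Real.posLog_eq_log (by rwa [abs_of_pos (by linarith)]), mul_assoc,
        Real.log_mul hl0.ne' (by linarith)]
      linarith
    · rw [zero_mul, sub_nonneg]
      exact Real.posLog_le_posLog (by positivity) (by gcongr)
  · refine Finset.sum_le_sum fun u hu ↦ ?_
    rw [← mul_sub, mul_assoc (divisor F Set.univ u : ℝ)]
    refine mul_le_mul_of_nonneg_left ?_ (hD u)
    have hu' : ‖u‖ ≤ l * R := by
      simp only [Set.Finite.mem_toFinset, Set.mem_ofPred_eq] at hu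
      exact hu.2
    rw [if_pos hu', one_mul]
    by_cases h0 : u = 0
    · simp [h0, Real.log_mul hl0.ne' hR.ne']
    have hun : 0 < ‖u‖ := norm_pos_iff.2 h0
    simp only [h0, if_false]
    rw [mul_assoc]
    exact posLog_mul_sub_posLog_le hl

/-- By Jensen's formula, the growth of the circle means of `log ‖F‖` determines the asymptotic
density of the zeros of `F`. -/
theorem tendsto_zeroCount_div (hF : Differentiable ℂ F) {c : ℝ} (hc : 0 ≤ c)
    (h : Tendsto (fun R ↦ Real.circleAverage (fun z ↦ Real.log ‖F z‖) 0 R / R) atTop (𝓝 c)) :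
    Tendsto (fun R ↦ (zeroCount F R : ℝ) / R) atTop (𝓝 c) := by
  refine tendsto_div_of_log_increments (N := logCounting (divisor F Set.univ))
    (fun R hR l hl ↦ (logCounting_increment_bounds hF hR hl).1)
    (fun R hR l hl ↦ (logCounting_increment_bounds hF hR hl).2) hc ?_
  have hmero : Meromorphic F := fun z ↦ (hF.analyticAt z).meromorphicAt
  have h1 := h.sub (tendsto_inv_atTop_zero.const_mul
    (Real.log ‖meromorphicTrailingCoeffAt F 0‖))
  rw [mul_zero, sub_zero] at h1
  refine h1.congr' ?_
  filter_upwards [eventually_gt_atTop 0] with R hR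
  rw [logCounting_divisor_eq_circleAverage_sub_const hmero hR.ne']
  ring

end Counting

/-! ### Zeros of exponential polynomials -/

/-- The exponential polynomial with frequencies `β ∈ S` and polynomial coefficients `p β`. -/
noncomputable def expPoly (S : Finset ℝ) (p : ℝ → Polynomial ℂ) (z : ℂ) : ℂ :=
  ∑ β ∈ S, (p β).eval z * Complex.exp (Complex.I * z * β)

theorem norm_exp_I_mul_mul (z : ℂ) (β : ℝ) :
    ‖Complex.exp (Complex.I * z * β)‖ = Real.exp (-β * z.im) := by
  rw [Complex.norm_exp]
  congr 1
  simp
  ring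

theorem Polynomial.norm_eval_le (p : Polynomial ℂ) {n : ℕ} (hn : p.natDegree ≤ n) (z : ℂ) :
    ‖p.eval z‖ ≤ (∑ i ∈ Finset.range (p.natDegree + 1), ‖p.coeff i‖) * (1 + ‖z‖) ^ n := by
  rw [Polynomial.eval_eq_sum_range, Finset.sum_mul]
  refine (norm_sum_le _ _).trans (Finset.sum_le_sum fun i hi ↦ ?_)
  rw [norm_mul, norm_pow]
  have h1 : 0 ≤ ‖z‖ := norm_nonneg z
  have h2 : i ≤ n := by have := Finset.mem_range.1 hi; omega
  gcongr
  calc ‖z‖ ^ i ≤ (1 + ‖z‖) ^ i := by gcongr; linarith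
    _ ≤ (1 + ‖z‖) ^ n := pow_le_pow_right₀ (by linarith) h2

theorem Polynomial.exists_le_norm_eval {p : Polynomial ℂ} (hp : p ≠ 0) :
    ∃ c > 0, ∀ᶠ z in Bornology.cobounded ℂ, c ≤ ‖p.eval z‖ := by
  rcases Nat.eq_zero_or_pos p.natDegree with h | h
  · rw [Polynomial.eq_C_of_natDegree_eq_zero h] at hp ⊢
    have : p.coeff 0 ≠ 0 := by simpa using hp
    exact ⟨‖p.coeff 0‖, norm_pos_iff.2 this, by simp⟩
  · refine ⟨1, one_pos, ?_⟩
    have := Polynomial.tendsto_norm_atTop p (Polynomial.natDegree_pos_iff_degree_pos.1 h)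
      (tendsto_norm_cobounded_atTop (E := ℂ))
    exact this.eventually_ge_atTop 1

theorem tendsto_one_add_pow_mul_exp_neg (n : ℕ) {a : ℝ} (ha : 0 < a) :
    Tendsto (fun R : ℝ ↦ (1 + R) ^ n * Real.exp (-a * R)) atTop (𝓝 0) := by
  have h1 := (Real.tendsto_pow_mul_exp_neg_atTop_nhds_zero n).comp
    ((tendsto_atTop_add_const_left atTop (1 : ℝ) tendsto_id).const_mul_atTop ha)
  have h2 := h1.const_mul ((a ^ n)⁻¹ * Real.exp a)
  rw [mul_zero] at h2
  refine h2.congr fun R ↦ ?_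
  have h3 : Real.exp (-a * R) = Real.exp a * Real.exp (-(a * (1 + R))) := by
    rw [← Real.exp_add]; congr 1; ring
  simp only [Function.comp, id, mul_pow]
  rw [h3]
  field_simp

theorem expPoly_upper_bound (S : Finset ℝ) (p : ℝ → Polynomial ℂ) {b : ℝ}
    (hS : ∀ β ∈ S, 0 ≤ β ∧ β ≤ b) : ∃ C : ℝ, 1 ≤ C ∧ ∃ n : ℕ, ∀ z,
      ‖expPoly S p z‖ ≤ C * (1 + ‖z‖) ^ n * Real.exp (b * max 0 (-z.im)) := by
  set n := S.sup fun β ↦ (p β).natDegree with hn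
  set K : ℝ → ℝ := fun β ↦ ∑ i ∈ Finset.range ((p β).natDegree + 1), ‖(p β).coeff i‖ with hK
  have hK0 : ∀ β, 0 ≤ K β := fun β ↦ Finset.sum_nonneg fun i _ ↦ norm_nonneg _
  refine ⟨max 1 (∑ β ∈ S, K β), le_max_left _ _, n, fun z ↦ ?_⟩
  have h1 : ‖expPoly S p z‖ ≤ (∑ β ∈ S, K β) * (1 + ‖z‖) ^ n * Real.exp (b * max 0 (-z.im)) := by
    rw [expPoly, Finset.sum_mul, Finset.sum_mul]
    refine (norm_sum_le _ _).trans (Finset.sum_le_sum fun β hβ ↦ ?_)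
    rw [norm_mul, norm_exp_I_mul_mul]
    have h2 : ‖(p β).eval z‖ ≤ K β * (1 + ‖z‖) ^ n :=
      (p β).norm_eval_le (Finset.le_sup (f := fun β ↦ (p β).natDegree) hβ) z
    have h3 : -β * z.im ≤ b * max 0 (-z.im) := by
      obtain ⟨h4, h5⟩ := hS β hβ
      calc -β * z.im = β * (-z.im) := by ring
        _ ≤ β * max 0 (-z.im) := by gcongr; exact le_max_right _ _
        _ ≤ b * max 0 (-z.im) := by gcongr
    have := hK0 β
    gcongr
  refine h1.trans ?_
  gcongr
  exact le_max_right _ _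

/-- In a sector of the upper half-plane the zero frequency term of an exponential polynomial
dominates the terms with positive frequencies. -/
theorem exists_le_norm_expPoly (S : Finset ℝ) (p : ℝ → Polynomial ℂ) (hS : ∀ β ∈ S, 0 ≤ β)
    (h0 : 0 ∈ S) (hp : p 0 ≠ 0) : ∃ c > 0, ∀ s > 0, ∀ᶠ R : ℝ in atTop, ∀ z : ℂ, ‖z‖ = R →
      s * R ≤ z.im → c ≤ ‖expPoly S p z‖ := by
  obtain ⟨c, hc, hcev⟩ := Polynomial.exists_le_norm_eval hp
  refine ⟨c / 2, by positivity, fun s hs ↦ ?_⟩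
  set K : ℝ → ℝ := fun β ↦ ∑ i ∈ Finset.range ((p β).natDegree + 1), ‖(p β).coeff i‖ with hK
  have hK0 : ∀ β, 0 ≤ K β := fun β ↦ Finset.sum_nonneg fun i _ ↦ norm_nonneg _
  have hlim : Tendsto (fun R : ℝ ↦ ∑ β ∈ S.erase 0,
      K β * ((1 + R) ^ (p β).natDegree * Real.exp (-(β * s) * R))) atTop (𝓝 0) := by
    have hsum := tendsto_finsetSum (S.erase 0) (x := (atTop : Filter ℝ)) (a := fun _ ↦ (0 : ℝ))
      (f := fun β R ↦ K β * ((1 + R) ^ (p β).natDegree * Real.exp (-(β * s) * R))) ?_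
    · simpa using hsum
    intro β hβ
    have hβ0 : 0 < β := lt_of_le_of_ne (hS β (Finset.mem_of_mem_erase hβ))
      (Finset.ne_of_mem_erase hβ).symm
    have := (tendsto_one_add_pow_mul_exp_neg (p β).natDegree (mul_pos hβ0 hs)).const_mul (K β)
    rwa [mul_zero] at this
  obtain ⟨r, hr⟩ : ∃ r : ℝ, ∀ z : ℂ, r ≤ ‖z‖ → c ≤ ‖(p 0).eval z‖ := by
    rw [← comap_norm_atTop, eventually_comap] at hcev
    obtain ⟨r, hr⟩ := eventually_atTop.1 hcev
    exact ⟨r, fun z hz ↦ hr ‖z‖ hz z rfl⟩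
  filter_upwards [hlim.eventually_lt_const (by positivity : (0 : ℝ) < c / 2),
    eventually_ge_atTop r] with R hR hRr z hz him
  rw [expPoly, ← Finset.add_sum_erase S _ h0]
  have h1 : ‖∑ β ∈ S.erase 0, (p β).eval z * Complex.exp (Complex.I * z * β)‖ ≤
      ∑ β ∈ S.erase 0, K β * ((1 + R) ^ (p β).natDegree * Real.exp (-(β * s) * R)) := by
    refine (norm_sum_le _ _).trans (Finset.sum_le_sum fun β hβ ↦ ?_)
    have hβ0 := hS β (Finset.mem_of_mem_erase hβ)
    rw [norm_mul, norm_exp_I_mul_mul, ← mul_assoc]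
    have h2 : ‖(p β).eval z‖ ≤ K β * (1 + R) ^ (p β).natDegree := by
      rw [← hz]; exact (p β).norm_eval_le le_rfl z
    have h3 : -β * z.im ≤ -(β * s) * R := by nlinarith
    have := h2.trans' (norm_nonneg _)
    gcongr
  have h2 := hr z (by rw [hz]; exact hRr)
  have h3 : ‖(p 0).eval z * Complex.exp (Complex.I * z * (0 : ℝ))‖ = ‖(p 0).eval z‖ := by simp
  have h4 := norm_sub_le_norm_add ((p 0).eval z * Complex.exp (Complex.I * z * (0 : ℝ)))
    (∑ β ∈ S.erase 0, (p β).eval z * Complex.exp (Complex.I * z * β))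
  rw [h3] at h4
  linarith

/-- Reflection `z ↦ -z` exchanges the roles of the smallest and the largest frequency. -/
theorem expPoly_reflect (S : Finset ℝ) (p : ℝ → Polynomial ℂ) (b : ℝ) (z : ℂ) :
    expPoly (S.image fun β ↦ b - β) (fun γ ↦ (p (b - γ)).comp (-Polynomial.X)) (-z)
      = expPoly S p z * Complex.exp (-(Complex.I * z * b)) := by
  rw [expPoly, expPoly, Finset.sum_image (by intro x _ y _ h; simpa using h), Finset.sum_mul]
  refine Finset.sum_congr rfl fun β _ ↦ ?_
  rw [mul_assoc (Polynomial.eval z (p β)), ← Complex.exp_add]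
  simp only [sub_sub_cancel, Polynomial.eval_comp, Polynomial.eval_neg, Polynomial.eval_X, neg_neg]
  congr 2
  push_cast
  ring

theorem expPoly_lower_bound (S : Finset ℝ) (p : ℝ → Polynomial ℂ) {b : ℝ}
    (hS : ∀ β ∈ S, 0 ≤ β ∧ β ≤ b) (h0 : 0 ∈ S) (hp0 : p 0 ≠ 0) (hb : b ∈ S) (hpb : p b ≠ 0) :
    ∃ c > 0, ∀ s > 0, ∀ᶠ R : ℝ in atTop, ∀ z : ℂ, ‖z‖ = R → s * R ≤ |z.im| →
      c * Real.exp (b * max 0 (-z.im)) ≤ ‖expPoly S p z‖ := by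
  obtain ⟨c₁, hc₁, h₁⟩ := exists_le_norm_expPoly S p (fun β hβ ↦ (hS β hβ).1) h0 hp0
  obtain ⟨c₂, hc₂, h₂⟩ := exists_le_norm_expPoly (S.image fun β ↦ b - β)
    (fun γ ↦ (p (b - γ)).comp (-Polynomial.X))
    (by
      intro γ hγ
      obtain ⟨β, hβ, rfl⟩ := Finset.mem_image.1 hγ
      linarith [(hS β hβ).2])
    (Finset.mem_image.2 ⟨b, hb, sub_self b⟩)
    (by
      intro h
      rw [sub_zero] at h
      have := congrArg (fun q : Polynomial ℂ ↦ q.comp (-Polynomial.X)) h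
      simp only [Polynomial.comp_assoc, Polynomial.neg_comp, Polynomial.X_comp, neg_neg,
        Polynomial.comp_X, Polynomial.zero_comp] at this
      exact hpb this)
  refine ⟨min c₁ c₂, lt_min hc₁ hc₂, fun s hs ↦ ?_⟩
  filter_upwards [h₁ s hs, h₂ s hs, eventually_ge_atTop 0] with R hR₁ hR₂ hR0 z hz him
  have hsR : 0 ≤ s * R := by positivity
  rcases le_total 0 z.im with h | h
  · rw [max_eq_left (by linarith), mul_zero, Real.exp_zero, mul_one]
    rw [abs_of_nonneg h] at him
    exact (min_le_left _ _).trans (hR₁ z hz him)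
  · rw [max_eq_right (by linarith)]
    rw [abs_of_nonpos h] at him
    have h3 := hR₂ (-z) (by rwa [norm_neg]) (by simpa using him)
    rw [expPoly_reflect, norm_mul] at h3
    have h4 : ‖Complex.exp (-(Complex.I * z * b))‖ = Real.exp (b * z.im) := by
      rw [Complex.norm_exp]; congr 1; simp; ring
    rw [h4] at h3
    have h5 : Real.exp (b * z.im) * Real.exp (b * -z.im) = 1 := by
      rw [← Real.exp_add]; simp
    calc min c₁ c₂ * Real.exp (b * -z.im) ≤ c₂ * Real.exp (b * -z.im) := by
          gcongr; exact min_le_right _ _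
      _ ≤ ‖expPoly S p z‖ * Real.exp (b * z.im) * Real.exp (b * -z.im) := by gcongr
      _ = ‖expPoly S p z‖ := by rw [mul_assoc, h5, mul_one]

theorem differentiable_expPoly (S : Finset ℝ) (p : ℝ → Polynomial ℂ) :
    Differentiable ℂ (expPoly S p) := by
  unfold expPoly
  have h (q : Polynomial ℂ) : Differentiable ℂ fun z ↦ q.eval z := q.differentiable
  fun_prop

/-- The zeros of an exponential polynomial with smallest frequency `0` and largest frequency `b`
have asymptotic density `b / π`. -/
theorem tendsto_zeroCount_expPoly_div (S : Finset ℝ) (p : ℝ → Polynomial ℂ) {b : ℝ}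
    (hS : ∀ β ∈ S, 0 ≤ β ∧ β ≤ b) (h0 : 0 ∈ S) (hp0 : p 0 ≠ 0) (hb : b ∈ S) (hpb : p b ≠ 0) :
    Tendsto (fun R ↦ (zeroCount (expPoly S p) R : ℝ) / R) atTop (𝓝 (b / Real.pi)) := by
  have hb0 := (hS b hb).1
  obtain ⟨C, hC, n, hU⟩ := expPoly_upper_bound S p hS
  obtain ⟨c, hc, hL⟩ := expPoly_lower_bound S p hS h0 hp0 hb hpb
  have hd := differentiable_expPoly S p
  exact tendsto_zeroCount_div hd (by positivity)
    (tendsto_circleAverage_log_norm_div hd hb0 hC hU hc hL)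

/-! ### The characteristic determinant as an exponential polynomial -/

namespace PointInteraction

variable {N : ℕ}

/-- The length `∑ j, |Y_j - Y_{σ(j)}|` of a permutation of the centers. -/
noncomputable def permLength (Y : Fin N → E3) (σ : Equiv.Perm (Fin N)) : ℝ :=
  ∑ j, ‖Y j - Y (σ j)‖

/-- The polynomial in `z` that multiplies `exp (i z |Y_i - Y_j|)` in the entry `(i, j)` of `Γ_Y(z)`:
`α - i z / (4π)` on the diagonal and the constant `-1 / (4π |Y_i - Y_j|)` off the diagonal. -/
noncomputable def entryCoeff (α : ℂ) (Y : Fin N → E3) (i j : Fin N) : Polynomial ℂ :=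
  if i = j then Polynomial.C α - Polynomial.C (Complex.I / (4 * (Real.pi : ℂ))) * Polynomial.X
  else Polynomial.C (-(1 / (4 * (Real.pi : ℂ) * (‖Y i - Y j‖ : ℂ))))

/-- The polynomial coefficient of `exp (i z permLength Y σ)` in the Leibniz expansion of
`det Γ_Y(z)`. -/
noncomputable def permCoeff (α : ℂ) (Y : Fin N → E3) (σ : Equiv.Perm (Fin N)) : Polynomial ℂ :=
  Polynomial.C (Equiv.Perm.sign σ : ℂ) * ∏ j, entryCoeff α Y j (σ j)

/-- The coefficient of the frequency `β` in `det Γ_Y`. -/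
noncomputable def freqCoeff (α : ℂ) (Y : Fin N → E3) (β : ℝ) : Polynomial ℂ :=
  ∑ σ with permLength Y σ = β, permCoeff α Y σ

theorem linearFactor_ne_zero (α : ℂ) :
    Polynomial.C α - Polynomial.C (Complex.I / (4 * (Real.pi : ℂ))) * Polynomial.X ≠ 0 := by
  intro h
  have h1 := congrArg (fun p ↦ Polynomial.coeff p 1) h
  have hπ : (Real.pi : ℂ) ≠ 0 := by exact_mod_cast Real.pi_ne_zero
  simp [Polynomial.coeff_C, hπ] at h1

theorem norm_sub_pos_of_mem_admissible {Y : Fin N → E3} (hY : Y ∈ admissible N) {i j : Fin N}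
    (h : i ≠ j) : 0 < ‖Y i - Y j‖ :=
  norm_pos_iff.2 (sub_ne_zero.2 (hY i j h))

theorem permCoeff_ne_zero (α : ℂ) {Y : Fin N → E3} (hY : Y ∈ admissible N)
    (σ : Equiv.Perm (Fin N)) : permCoeff α Y σ ≠ 0 := by
  refine mul_ne_zero (by simp) (Finset.prod_ne_zero_iff.2 fun j _ ↦ ?_)
  rw [entryCoeff]
  split_ifs with hj
  · exact linearFactor_ne_zero α
  · have h1 : (‖Y j - Y (σ j)‖ : ℂ) ≠ 0 := by
      exact_mod_cast (norm_sub_pos_of_mem_admissible hY hj).ne'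
    have hπ : (Real.pi : ℂ) ≠ 0 := by exact_mod_cast Real.pi_ne_zero
    simp [h1, hπ]

theorem permLength_nonneg (Y : Fin N → E3) (σ : Equiv.Perm (Fin N)) : 0 ≤ permLength Y σ :=
  Finset.sum_nonneg fun _ _ ↦ norm_nonneg _

theorem permLength_one (Y : Fin N → E3) : permLength Y 1 = 0 := by
  simp [permLength]

theorem permLength_eq_zero_iff {Y : Fin N → E3} (hY : Y ∈ admissible N)
    (σ : Equiv.Perm (Fin N)) : permLength Y σ = 0 ↔ σ = 1 := by
  constructor
  · intro h
    ext1 j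
    by_contra hj
    have h1 := (Finset.sum_eq_zero_iff_of_nonneg fun _ _ ↦ norm_nonneg _).1 h j (Finset.mem_univ j)
    exact (norm_sub_pos_of_mem_admissible hY (Ne.symm hj)).ne' h1
  · rintro rfl
    exact permLength_one Y

theorem permLength_le_size (Y : Fin N → E3) (σ : Equiv.Perm (Fin N)) :
    permLength Y σ ≤ PointInteraction.size Y :=
  Finset.le_sup' (fun σ ↦ permLength Y σ) (Finset.mem_univ σ)

theorem exists_permLength_eq_size (Y : Fin N → E3) :
    ∃ σ, permLength Y σ = PointInteraction.size Y := by
  obtain ⟨σ, -, h⟩ := Finset.exists_mem_eq_sup' (Finset.univ_nonempty)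
    (fun σ : Equiv.Perm (Fin N) ↦ permLength Y σ)
  exact ⟨σ, h.symm⟩

theorem charDet_eq_sum (α : ℂ) {Y : Fin N → E3} (hY : Y ∈ admissible N) (z : ℂ) :
    charDet α Y z = ∑ σ : Equiv.Perm (Fin N),
      (permCoeff α Y σ).eval z * Complex.exp (Complex.I * z * permLength Y σ) := by
  rw [charDet, Matrix.det_apply']
  refine Finset.sum_congr rfl fun σ _ ↦ ?_
  have hentry (i : Fin N) : gammaMatrix α Y z (σ i) i =
      (entryCoeff α Y i (σ i)).eval z * Complex.exp (Complex.I * z * (‖Y i - Y (σ i)‖ : ℂ)) := by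
    simp only [gammaMatrix, Matrix.of_apply, greenTilde, entryCoeff]
    by_cases h : i = σ i
    · simp [← h]
      ring
    · rw [if_neg h, if_neg (Ne.symm h), if_neg (sub_ne_zero.2 (hY _ _ (Ne.symm h))),
        norm_sub_rev (Y (σ i)), Polynomial.eval_C]
      ring
  simp only [hentry]
  rw [Finset.prod_mul_distrib, ← Complex.exp_sum]
  simp only [permCoeff, permLength, Polynomial.eval_mul, Polynomial.eval_C, Polynomial.eval_prod]
  push_cast
  rw [Finset.mul_sum]
  ring

/-- The frequencies that occur in `det Γ_Y` with a nonzero coefficient. -/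
noncomputable def freqSet (α : ℂ) (Y : Fin N → E3) : Finset ℝ :=
  open Classical in
  (Finset.univ.image (permLength Y)).filter fun β ↦ freqCoeff α Y β ≠ 0

theorem mem_freqSet {α : ℂ} {Y : Fin N → E3} {β : ℝ} :
    β ∈ freqSet α Y ↔ (∃ σ, permLength Y σ = β) ∧ freqCoeff α Y β ≠ 0 := by
  simp [freqSet]

theorem charDet_eq_expPoly (α : ℂ) {Y : Fin N → E3} (hY : Y ∈ admissible N) :
    charDet α Y = expPoly (freqSet α Y) (freqCoeff α Y) := by
  classical
  ext z
  rw [charDet_eq_sum α hY, expPoly, freqSet, Finset.sum_filter_of_ne,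
    ← Finset.sum_fiberwise_of_maps_to (t := Finset.univ.image (permLength Y)) (g := permLength Y)
      fun σ _ ↦ Finset.mem_image_of_mem _ (Finset.mem_univ σ)]
  · refine Finset.sum_congr rfl fun β _ ↦ ?_
    rw [freqCoeff, Polynomial.eval_finsetSum, Finset.sum_mul]
    refine Finset.sum_congr (by congr) fun σ hσ ↦ ?_
    rw [(Finset.mem_filter.1 hσ).2]
  · intro β _ h h0
    simp [h0] at h

theorem freqCoeff_zero_ne_zero (α : ℂ) {Y : Fin N → E3} (hY : Y ∈ admissible N) :
    freqCoeff α Y 0 ≠ 0 := by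
  have : (Finset.univ.filter fun σ ↦ permLength Y σ = 0) = {1} := by
    ext σ
    simp [permLength_eq_zero_iff hY]
  rw [freqCoeff, this, Finset.sum_singleton]
  exact permCoeff_ne_zero α hY 1

theorem zero_mem_freqSet (α : ℂ) {Y : Fin N → E3} (hY : Y ∈ admissible N) : 0 ∈ freqSet α Y :=
  mem_freqSet.2 ⟨⟨1, permLength_one Y⟩, freqCoeff_zero_ne_zero α hY⟩

/-- The resonances of `H_Y` have asymptotic density `b / π`, where `b` is the largest frequency that
survives in `det Γ_Y`. -/
theorem tendsto_resonanceCount_div (α : ℂ) {Y : Fin N → E3} (hY : Y ∈ admissible N) :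
    Tendsto (fun R : ℝ ↦ (resonanceCount α Y R : ℝ) / R) atTop
      (𝓝 ((freqSet α Y).max' ⟨0, zero_mem_freqSet α hY⟩ / Real.pi)) := by
  set b := (freqSet α Y).max' ⟨0, zero_mem_freqSet α hY⟩ with hb
  have hbm : b ∈ freqSet α Y := Finset.max'_mem _ _
  have h := tendsto_zeroCount_expPoly_div (freqSet α Y) (freqCoeff α Y) (b := b)
    (fun β hβ ↦ ⟨by
      obtain ⟨σ, rfl⟩ := (mem_freqSet.1 hβ).1
      exact permLength_nonneg Y σ, Finset.le_max' _ _ hβ⟩)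
    (zero_mem_freqSet α hY) (freqCoeff_zero_ne_zero α hY) hbm (mem_freqSet.1 hbm).2
  rw [← charDet_eq_expPoly α hY] at h
  exact h

theorem asymptoticDensity_eq (α : ℂ) {Y : Fin N → E3} (hY : Y ∈ admissible N) :
    asymptoticDensity α Y = (freqSet α Y).max' ⟨0, zero_mem_freqSet α hY⟩ / Real.pi :=
  (tendsto_resonanceCount_div α hY).limUnder_eq

theorem asymptoticDensity_le (α : ℂ) {Y : Fin N → E3} (hY : Y ∈ admissible N) :
    asymptoticDensity α Y ≤ PointInteraction.size Y / Real.pi := by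
  rw [asymptoticDensity_eq α hY]
  gcongr
  obtain ⟨σ, hσ⟩ := (mem_freqSet.1 (Finset.max'_mem _ ⟨0, zero_mem_freqSet α hY⟩)).1
  rw [← hσ]
  exact permLength_le_size Y σ

theorem size_div_pi_le_asymptoticDensity {α : ℂ} {Y : Fin N → E3} (hY : Y ∈ admissible N)
    (h : freqCoeff α Y (PointInteraction.size Y) ≠ 0) :
    PointInteraction.size Y / Real.pi ≤ asymptoticDensity α Y := by
  rw [asymptoticDensity_eq α hY]
  gcongr
  exact Finset.le_max' _ _ (mem_freqSet.2 ⟨exists_permLength_eq_size Y, h⟩)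

end PointInteraction

/-! ### Permutations with the same edges -/

namespace PointInteraction

section Combinatorics

variable {ι : Type*} [DecidableEq ι]

/-- The multiplicity of the undirected edge `{i, j}` in the functional graph of `σ`; a fixed point
counts as a double loop. -/
def edgeMult (σ : Equiv.Perm ι) (i j : ι) : ℕ :=
  (if σ i = j then 1 else 0) + (if σ⁻¹ i = j then 1 else 0)

/-- Two permutations have the same undirected edges, apart from loops. Equivalently, one arises from
the other by reversing some of its cycles. -/
def SameEdges (σ τ : Equiv.Perm ι) : Prop :=
  ∀ i j, i ≠ j → edgeMult σ i j = edgeMult τ i j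

theorem sum_edgeMult [Fintype ι] (σ : Equiv.Perm ι) (i : ι) : ∑ j, edgeMult σ i j = 2 := by
  simp [edgeMult, Finset.sum_add_distrib]

namespace SameEdges

variable {σ τ : Equiv.Perm ι}

theorem edgeMult_eq [Fintype ι] (h : SameEdges σ τ) (i j : ι) : edgeMult σ i j = edgeMult τ i j := by
  by_cases hij : i = j
  · subst hij
    have h1 := sum_edgeMult σ i
    have h2 := sum_edgeMult τ i
    rw [← Finset.add_sum_erase _ _ (Finset.mem_univ i)] at h1 h2
    have h3 : ∑ j ∈ Finset.univ.erase i, edgeMult σ i j = ∑ j ∈ Finset.univ.erase i, edgeMult τ i j :=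
      Finset.sum_congr rfl fun j hj ↦ h i j (Finset.ne_of_mem_erase hj).symm
    omega
  · exact h i j hij

variable [Fintype ι]

theorem apply_eq_or (h : SameEdges σ τ) (i : ι) : τ i = σ i ∨ τ i = σ⁻¹ i := by
  have h1 := h.edgeMult_eq i (τ i)
  unfold edgeMult at h1
  by_contra! h2
  rw [if_neg h2.1.symm, if_neg h2.2.symm, if_pos rfl] at h1
  omega

theorem apply_eq_iff_inv (h : SameEdges σ τ) (i : ι) : τ i = σ i ↔ τ⁻¹ i = σ⁻¹ i := by
  constructor
  · intro h1
    have h2 := h.edgeMult_eq i (τ⁻¹ i)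
    unfold edgeMult at h2
    rw [h1, if_pos (rfl : τ⁻¹ i = τ⁻¹ i)] at h2
    by_contra h3
    rw [if_neg (Ne.symm h3)] at h2
    omega
  · intro h1
    have h2 := h.edgeMult_eq i (τ i)
    unfold edgeMult at h2
    rw [h1, if_pos (rfl : τ i = τ i)] at h2
    by_contra h3
    rw [if_neg (Ne.symm h3)] at h2
    omega

/-- The set on which two permutations with the same edges agree is invariant. -/
theorem apply_apply_eq_iff (h : SameEdges σ τ) (i : ι) : τ (σ i) = σ (σ i) ↔ τ i = σ i := by
  rw [h.apply_eq_iff_inv, (by simp : σ⁻¹ (σ i) = i), Equiv.Perm.inv_eq_iff_eq, eq_comm]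

theorem sign_eq (h : SameEdges σ τ) : Equiv.Perm.sign σ = Equiv.Perm.sign τ := by
  -- `τ σ` is `σ²` where `σ` and `τ` agree, and the identity elsewhere
  set ρ := Equiv.Perm.ofSubtype
    (σ.subtypePerm (p := fun i ↦ τ i = σ i) h.apply_apply_eq_iff) with hρ
  have hρ₁ (i : ι) (hi : τ i = σ i) : ρ i = σ i :=
    Equiv.Perm.ofSubtype_subtypePerm_of_mem (p := fun i ↦ τ i = σ i) h.apply_apply_eq_iff hi
  have hρ₂ (i : ι) (hi : ¬ τ i = σ i) : ρ i = i :=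
    Equiv.Perm.ofSubtype_subtypePerm_of_not_mem (p := fun i ↦ τ i = σ i) h.apply_apply_eq_iff hi
  have h1 : τ * σ = ρ ^ 2 := by
    ext1 i
    rw [pow_two, Equiv.Perm.mul_apply, Equiv.Perm.mul_apply]
    by_cases hi : τ i = σ i
    · have hi' := (h.apply_apply_eq_iff i).2 hi
      rw [hρ₁ i hi, hρ₁ _ hi', hi']
    · rw [hρ₂ i hi, hρ₂ i hi]
      rcases h.apply_eq_or (σ i) with h2 | h2
      · exact absurd ((h.apply_apply_eq_iff i).1 h2) hi
      · simpa using h2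
  have h2 := congrArg Equiv.Perm.sign h1
  rw [map_mul, map_pow, Int.units_sq] at h2
  rw [← mul_one (Equiv.Perm.sign τ), ← Int.units_mul_self (Equiv.Perm.sign σ), ← mul_assoc, h2,
    one_mul]

theorem prod_eq {M : Type*} [CommMonoid M] (h : SameEdges σ τ) (w : ι → ι → M)
    (hw : ∀ i j, w i j = w j i) : ∏ i, w i (σ i) = ∏ i, w i (τ i) := by
  rw [← Finset.prod_filter_mul_prod_filter_not Finset.univ (fun i ↦ τ i = σ i),
    ← Finset.prod_filter_mul_prod_filter_not Finset.univ (fun i ↦ τ i = σ i) (fun i ↦ w i (τ i))]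
  congr 1
  · exact Finset.prod_congr rfl fun i hi ↦ by rw [(Finset.mem_filter.1 hi).2]
  · refine Finset.prod_equiv σ (fun i ↦ ?_) fun i hi ↦ ?_
    · simp [h.apply_apply_eq_iff]
    · have hi' := (Finset.mem_filter.1 hi).2
      rcases h.apply_eq_or (σ i) with h2 | h2
      · exact absurd ((h.apply_apply_eq_iff i).1 h2) hi'
      · rw [h2, (by simp : σ⁻¹ (σ i) = i), hw]

end SameEdges

end Combinatorics

variable {N : ℕ}

theorem entryCoeff_comm (α : ℂ) (Y : Fin N → E3) (i j : Fin N) :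
    entryCoeff α Y i j = entryCoeff α Y j i := by
  simp only [entryCoeff, eq_comm (a := i), norm_sub_rev (Y i)]

/-- Reversing cycles does not change the term of a permutation in the Leibniz expansion, hence the
terms of permutations with the same edges do not cancel. -/
theorem SameEdges.permCoeff_eq (α : ℂ) (Y : Fin N → E3) {σ τ : Equiv.Perm (Fin N)}
    (h : SameEdges σ τ) : permCoeff α Y σ = permCoeff α Y τ := by
  rw [permCoeff, permCoeff, h.sign_eq, h.prod_eq _ (entryCoeff_comm α Y)]

theorem freqCoeff_size_ne_zero (α : ℂ) {Y : Fin N → E3} (hY : Y ∈ admissible N)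
    (h : ∀ σ τ : Equiv.Perm (Fin N), ¬ SameEdges σ τ → permLength Y σ ≠ permLength Y τ) :
    freqCoeff α Y (PointInteraction.size Y) ≠ 0 := by
  obtain ⟨σ, hσ⟩ := exists_permLength_eq_size Y
  have h1 : freqCoeff α Y (PointInteraction.size Y) =
      (Finset.univ.filter fun τ ↦ permLength Y τ = PointInteraction.size Y).card •
        permCoeff α Y σ := by
    rw [freqCoeff]
    refine Finset.sum_eq_card_nsmul fun τ hτ ↦ ?_
    by_contra h2
    refine h σ τ (fun h3 ↦ h2 (h3.permCoeff_eq α Y).symm) ?_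
    rw [hσ, (Finset.mem_filter.1 hτ).2]
  rw [h1]
  refine smul_ne_zero (Finset.card_ne_zero_of_mem (a := σ) ?_) (permCoeff_ne_zero α hY σ)
  simp [hσ]

/-- The function whose zero set contains the tuples with non-Weyl asymptotics: the product of all
differences of permutation lengths that are not forced to vanish. -/
noncomputable def discriminant (N : ℕ) (Y : Fin N → E3) : ℝ :=
  open Classical in
  ∏ q : Equiv.Perm (Fin N) × Equiv.Perm (Fin N) with ¬ SameEdges q.1 q.2,
    (permLength Y q.1 - permLength Y q.2)

theorem discriminant_eq_zero_iff {Y : Fin N → E3} :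
    discriminant N Y = 0 ↔ ∃ σ τ, ¬ SameEdges σ τ ∧ permLength Y σ - permLength Y τ = 0 := by
  simp [discriminant, Finset.prod_eq_zero_iff]

theorem discriminant_eq_zero_of_mem_nonWeylSet {α : ℂ} {Y : Fin N → E3}
    (h : Y ∈ nonWeylSet α N) : discriminant N Y = 0 := by
  obtain ⟨hY, hlt⟩ := h
  by_contra h0
  rw [discriminant_eq_zero_iff] at h0
  push Not at h0
  exact hlt.not_ge (size_div_pi_le_asymptoticDensity hY
    (freqCoeff_size_ne_zero α hY fun σ τ hst ↦ sub_ne_zero.1 (h0 σ τ hst)))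

end PointInteraction

/-! ### Null sets and analyticity -/

section NullSets

variable {E : Type*} [NormedAddCommGroup E] [NormedSpace ℝ E] [FiniteDimensional ℝ E]
  [MeasurableSpace E] [BorelSpace E] (μ : Measure E) [μ.IsAddHaarMeasure]

/-- A measurable set that meets every segment from the origin in a null set is null: by Fubini some
dilate of it is null. -/
theorem measure_eq_zero_of_forall_ae_smul_notMem {Z : Set E} (hZ : MeasurableSet Z)
    (h : ∀ x : E, ∀ᵐ t ∂(volume.restrict (Set.Ioo (0 : ℝ) 1)), t • x ∉ Z) : μ Z = 0 := by
  have hmeas : MeasurableSet {q : E × ℝ | q.2 • q.1 ∉ Z} :=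
    (hZ.preimage (by fun_prop : Measurable fun q : E × ℝ ↦ q.2 • q.1)).compl
  have h1 : ∀ᵐ x ∂μ, ∀ᵐ t ∂(volume.restrict (Set.Ioo (0 : ℝ) 1)), t • x ∉ Z := ae_of_all _ h
  rw [Measure.ae_ae_comm hmeas, ae_restrict_iff' measurableSet_Ioo] at h1
  obtain ⟨t, ht, h2⟩ : ∃ t ∈ Set.Ioo (0 : ℝ) 1, ∀ᵐ x ∂μ, t • x ∉ Z := by
    by_contra! hcon
    have h3 : (volume : Measure ℝ) (Set.Ioo (0 : ℝ) 1) = 0 := by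
      refine measure_mono_null (fun t ht ↦ ?_) (ae_iff.1 h1)
      simp only [Set.mem_ofPred_eq]
      intro h4
      exact hcon t ht (h4 ht)
    simp at h3
  have h4 : μ ((fun x ↦ t • x) ⁻¹' Z) = 0 :=
    measure_mono_null (fun x hx ↦ by simpa using hx) (ae_iff.1 h2)
  rw [Measure.addHaar_preimage_smul μ ht.1.ne'] at h4
  simpa [ht.1.ne'] using h4

/-- The zero set of a real-analytic function that does not vanish identically near any point is a
null set. -/
theorem measure_zeros_eq_zero_of_analyticOnNhd {f : E → ℝ} {A : Set E} (hA : IsOpen A)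
    (hf : AnalyticOnNhd ℝ f A) (hne : ∀ x ∈ A, ∃ᶠ y in 𝓝 x, f y ≠ 0) :
    μ {x | x ∈ A ∧ f x = 0} = 0 := by
  refine measure_null_of_locally_null _ fun x hx ↦ ?_
  obtain ⟨ε, hε, hball⟩ := Metric.isOpen_iff.1 hA x hx.1
  obtain ⟨p, hp0, hp⟩ := ((hne x hx.1).and_eventually
    (Metric.ball_mem_nhds x (half_pos hε))).exists
  have hsub : ∀ y ∈ Metric.ball (0 : E) (ε / 2), p + y ∈ A := by
    intro y hy
    apply hball
    rw [dist_eq_norm] at hp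
    rw [Metric.mem_ball, dist_eq_norm]
    rw [mem_ball_zero_iff] at hy
    calc ‖p + y - x‖ = ‖(p - x) + y‖ := by congr 1; abel
      _ ≤ ‖p - x‖ + ‖y‖ := norm_add_le _ _
      _ < ε := by linarith
  set Z : Set E := {y | y ∈ Metric.ball (0 : E) (ε / 2) ∧ f (p + y) = 0} with hZ
  have hcont : ContinuousOn (fun y ↦ f (p + y)) (Metric.ball (0 : E) (ε / 2)) :=
    hf.continuousOn.comp (by fun_prop) hsub
  have hZm : MeasurableSet Z := by
    have h1 := (hcont.isOpen_inter_preimage Metric.isOpen_ball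
      (isOpen_compl_singleton (x := (0 : ℝ)))).measurableSet
    have h2 : Z = Metric.ball (0 : E) (ε / 2) \
        (Metric.ball (0 : E) (ε / 2) ∩ (fun y ↦ f (p + y)) ⁻¹' {0}ᶜ) := by
      ext y
      simp only [hZ, Set.mem_ofPred_eq, Set.mem_sdiff, Set.mem_inter_iff, Set.mem_preimage,
        Set.mem_compl_iff, Set.mem_singleton_iff]
      tauto
    rw [h2]
    exact Metric.isOpen_ball.measurableSet.diff h1
  have hZ0 : μ Z = 0 := by
    refine measure_eq_zero_of_forall_ae_smul_notMem μ hZm fun y ↦ ?_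
    set I : Set ℝ := {t | t • y ∈ Metric.ball (0 : E) (ε / 2)} with hI
    have hIo : IsOpen I := Metric.isOpen_ball.preimage (by fun_prop : Continuous fun t : ℝ ↦ t • y)
    have hIc : Convex ℝ I :=
      (convex_ball (0 : E) (ε / 2)).linear_preimage (LinearMap.toSpanSingleton ℝ E y)
    have h0I : (0 : ℝ) ∈ I := by simp [hI, hε]
    have hg : AnalyticOnNhd ℝ (fun t : ℝ ↦ f (p + t • y)) I := by
      intro t ht
      refine AnalyticAt.fun_comp (hf _ (hsub _ ht)) ?_
      exact analyticAt_const.add (analyticAt_id.smul analyticAt_const)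
    have hcod := hg.preimage_zero_mem_codiscreteWithin (x := 0) (by simpa using hp0) h0I
      ⟨⟨0, h0I⟩, hIc.isPreconnected⟩
    have hae := ae_restrict_le_codiscreteWithin (μ := (volume : Measure ℝ)) hIo.measurableSet hcod
    have hae' : ∀ᵐ t ∂(volume : Measure ℝ), t ∈ I → f (p + t • y) ≠ 0 := by
      rw [← ae_restrict_iff' hIo.measurableSet]
      filter_upwards [hae] with t ht
      simpa using ht
    refine ae_restrict_of_ae ?_
    filter_upwards [hae'] with t ht hmem
    exact ht hmem.1 hmem.2
  refine ⟨{x | x ∈ A ∧ f x = 0} ∩ Metric.ball p (ε / 2), inter_mem_nhdsWithin _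
    (Metric.isOpen_ball.mem_nhds (by rwa [Metric.mem_ball, dist_comm])), ?_⟩
  refine measure_mono_null (t := (fun y ↦ y + -p) ⁻¹' Z) ?_ ?_
  · rintro y ⟨⟨-, hy0⟩, hy⟩
    simp only [Set.mem_preimage, hZ, Set.mem_ofPred_eq, mem_ball_zero_iff]
    rw [Metric.mem_ball, dist_eq_norm] at hy
    refine ⟨by rwa [← sub_eq_add_neg], ?_⟩
    rwa [add_comm y, add_neg_cancel_left]
  · rw [measure_preimage_add_right, hZ0]

end NullSets

namespace PointInteraction

variable {N : ℕ}

theorem analyticAt_norm_comp {E : Type*} [NormedAddCommGroup E] [NormedSpace ℝ E] {f : E → E3}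
    {x : E} (hf : AnalyticAt ℝ f x) (h : f x ≠ 0) : AnalyticAt ℝ (fun y ↦ ‖f y‖) x :=
  AnalyticAt.fun_comp (contDiffAt_norm ℝ h).analyticAt hf

theorem isOpen_admissible (N : ℕ) : IsOpen (admissible N) := by
  have : admissible N = ⋂ (j : Fin N) (j' : Fin N) (_ : j ≠ j'), {Y | Y j ≠ Y j'} := by
    ext Y
    simp [admissible]
  rw [this]
  refine isOpen_iInter_of_finite fun j ↦ isOpen_iInter_of_finite fun j' ↦
    isOpen_iInter_of_finite fun _ ↦ ?_
  exact isOpen_ne_fun (continuous_apply j) (continuous_apply j')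

theorem admissible_nonempty (N : ℕ) : (admissible N).Nonempty := by
  refine ⟨fun j ↦ EuclideanSpace.single 0 (j : ℝ), fun j j' h h2 ↦ h ?_⟩
  have := congrArg (fun v : E3 ↦ v 0) h2
  simp only [PiLp.single_apply, if_true] at this
  exact Fin.ext (by exact_mod_cast this)

theorem analyticOnNhd_permLength (σ : Equiv.Perm (Fin N)) :
    AnalyticOnNhd ℝ (fun Y ↦ permLength Y σ) (admissible N) := by
  unfold permLength
  refine Finset.analyticOnNhd_fun_sum _ fun j _ Y hY ↦ ?_
  by_cases h : j = σ j
  · simp only [← h, sub_self, norm_zero]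
    exact analyticAt_const
  · have hp (i : Fin N) : AnalyticAt ℝ (fun Y : Fin N → E3 ↦ Y i) Y :=
      (ContinuousLinearMap.proj (R := ℝ) (φ := fun _ : Fin N ↦ E3) i).analyticAt Y
    exact analyticAt_norm_comp ((hp j).sub (hp (σ j))) (sub_ne_zero.2 (hY _ _ h))

/-- The length of a permutation as a sum over the edges of its functional graph. -/
theorem two_mul_permLength (Y : Fin N → E3) (σ : Equiv.Perm (Fin N)) :
    2 * permLength Y σ = ∑ q : Fin N × Fin N, (edgeMult σ q.1 q.2 : ℝ) * ‖Y q.1 - Y q.2‖ := by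
  rw [Fintype.sum_prod_type]
  have h1 : ∑ i, ‖Y i - Y (σ⁻¹ i)‖ = permLength Y σ := by
    rw [permLength, ← Equiv.sum_comp σ]
    refine Finset.sum_congr rfl fun i _ ↦ ?_
    rw [(by simp : σ⁻¹ (σ i) = i), norm_sub_rev]
  have h2 : ∑ i, ‖Y i - Y (σ i)‖ = permLength Y σ := rfl
  simp only [edgeMult, Nat.cast_add, Nat.cast_ite, Nat.cast_one, Nat.cast_zero, add_mul, ite_mul,
    one_mul, zero_mul, Finset.sum_add_distrib, Finset.sum_ite_eq, Finset.mem_univ, if_true]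
  rw [h1, h2]
  ring

theorem edgeMult_comm {ι : Type*} [DecidableEq ι] (σ : Equiv.Perm ι) (i j : ι) :
    edgeMult σ i j = edgeMult σ j i := by
  have h (i j : ι) : σ⁻¹ i = j ↔ σ j = i := by
    rw [Equiv.Perm.inv_eq_iff_eq, eq_comm]
  simp only [edgeMult, h, add_comm]

section MovingOneCenter

variable {Y : Fin N → E3} {a b : Fin N}

theorem analyticAt_norm_update_sub (Y : Fin N → E3) (a : Fin N) {i j : Fin N} {y : E3}
    (h : i = j ∨ Function.update Y a y i ≠ Function.update Y a y j) :
    AnalyticAt ℝ (fun y ↦ ‖Function.update Y a y i - Function.update Y a y j‖) y := by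
  rcases h with rfl | h
  · simp only [sub_self, norm_zero]
    exact analyticAt_const
  · have hp (i : Fin N) : AnalyticAt ℝ (fun y : E3 ↦ Function.update Y a y i) y := by
      by_cases hi : i = a
      · subst hi
        simp only [Function.update_self]
        exact analyticAt_id
      · simp only [Function.update_of_ne hi]
        exact analyticAt_const
    exact analyticAt_norm_comp ((hp i).sub (hp j)) (sub_ne_zero.2 h)

/-- A weighted sum of distances between the centers with a nonzero weight `w (a, b)` does not vanish
identically near an admissible `Y`. Otherwise, by analytic continuation along the possible positions
`y` of the center `a`, it would vanish for all `y`, but it is not differentiable at `y = Y b`. -/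
theorem frequently_weighted_distances_ne_zero (hY : Y ∈ admissible N) (hab : a ≠ b)
    (w : Fin N × Fin N → ℝ) (hsymm : ∀ i j, w (i, j) = w (j, i)) (hw : w (a, b) ≠ 0) :
    ∃ᶠ X in 𝓝 Y, ∑ q : Fin N × Fin N, w q * ‖X q.1 - X q.2‖ ≠ 0 := by
  intro hcon
  simp only [ne_eq, not_not] at hcon
  set U : E3 → Fin N → E3 := Function.update Y a with hU
  set g : E3 → ℝ := fun y ↦ ∑ q : Fin N × Fin N, w q * ‖U y q.1 - U y q.2‖ with hg
  have hUc : Continuous U := continuous_const.update a continuous_id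
  have hgc : Continuous g := by
    have hUi (i : Fin N) : Continuous fun y ↦ U y i := (continuous_apply i).comp hUc
    exact continuous_finsetSum _ fun q _ ↦ ((hUi q.1).sub (hUi q.2)).norm.const_mul _
  have hUa : U (Y a) = Y := Function.update_eq_self a Y
  have hg0 : g =ᶠ[𝓝 (Y a)] 0 := by
    have h1 : Tendsto U (𝓝 (Y a)) (𝓝 Y) := by
      have := hUc.tendsto (Y a)
      rwa [hUa] at this
    exact h1.eventually hcon
  set T : Set E3 := Y '' {j | j ≠ a} with hT
  have hTc : T.Countable := (Set.toFinite _).countable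
  have hrank : 1 < Module.rank ℝ E3 := by
    rw [← Module.finrank_eq_rank, finrank_euclideanSpace_fin]
    norm_num
  have hgan : AnalyticOnNhd ℝ g Tᶜ := by
    refine Finset.analyticOnNhd_fun_sum _ fun q _ y hy ↦ analyticAt_const.mul
      (analyticAt_norm_update_sub Y a ?_)
    by_cases hq : q.1 = q.2
    · exact Or.inl hq
    · right
      by_cases h1 : q.1 = a
      · have h2 : q.2 ≠ a := fun h ↦ hq (h1.trans h.symm)
        rw [h1, Function.update_self, Function.update_of_ne h2]
        rintro rfl
        exact hy ⟨q.2, h2, rfl⟩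
      · by_cases h2 : q.2 = a
        · rw [h2, Function.update_self, Function.update_of_ne h1]
          rintro rfl
          exact hy ⟨q.1, h1, rfl⟩
        · rw [Function.update_of_ne h1, Function.update_of_ne h2]
          exact hY _ _ hq
  have hYa : Y a ∈ Tᶜ := by
    rintro ⟨j, hj, h⟩
    exact hY j a hj h
  have hzero := hgan.eqOn_zero_of_preconnected_of_eventuallyEq_zero
    (hTc.isConnected_compl_of_one_lt_rank hrank).isPreconnected hYa hg0
  have hgz : g = 0 := hgc.ext_on (hTc.dense_compl ℝ) continuous_zero hzero
  -- the summands for `(a, b)` and `(b, a)` are the only ones that are not smooth at `y = Y b`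
  have hsplit (y : E3) : 2 * w (a, b) * ‖y - Y b‖
      = g y - ∑ q ∈ (Finset.univ \ {(a, b), (b, a)} : Finset (Fin N × Fin N)),
        w q * ‖U y q.1 - U y q.2‖ := by
    have hUya : U y a = y := Function.update_self ..
    have hUyb : U y b = Y b := Function.update_of_ne hab.symm ..
    have h1 : ((a, b) : Fin N × Fin N) ≠ (b, a) := fun h ↦ hab (congrArg Prod.fst h)
    rw [show g y = ∑ q : Fin N × Fin N, w q * ‖U y q.1 - U y q.2‖ from rfl,
      ← Finset.sum_sdiff (Finset.subset_univ {(a, b), (b, a)}), Finset.sum_pair h1]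
    simp only [hUya, hUyb]
    rw [norm_sub_rev (Y b), ← hsymm a b]
    ring
  have hdiff : DifferentiableAt ℝ (fun y ↦ 2 * w (a, b) * ‖y - Y b‖) (Y b) := by
    simp only [hsplit, hgz, Pi.zero_apply, zero_sub]
    refine (AnalyticAt.differentiableAt ?_).neg
    refine Finset.analyticAt_fun_sum _ fun q hq ↦ analyticAt_const.mul
      (analyticAt_norm_update_sub Y a ?_)
    simp only [Finset.mem_sdiff, Finset.mem_univ, true_and, Finset.mem_insert,
      Finset.mem_singleton, not_or] at hq
    by_cases hq' : q.1 = q.2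
    · exact Or.inl hq'
    · right
      by_cases h1 : q.1 = a
      · have h2 : q.2 ≠ a := fun h ↦ hq' (h1.trans h.symm)
        rw [h1, Function.update_self, Function.update_of_ne h2]
        exact hY _ _ fun h ↦ hq.1 (Prod.ext h1 h.symm)
      · by_cases h2 : q.2 = a
        · rw [h2, Function.update_self, Function.update_of_ne h1]
          exact hY _ _ fun h ↦ hq.2 (Prod.ext h h2)
        · rw [Function.update_of_ne h1, Function.update_of_ne h2]
          exact hY _ _ hq'
  refine not_differentiableAt_norm_zero E3 ?_
  have h2 : DifferentiableAt ℝ (fun y ↦ 2 * w (a, b) * ‖y - Y b‖) (0 + Y b) := by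
    rwa [zero_add]
  have h3 := (h2.comp (0 : E3) (by fun_prop : DifferentiableAt ℝ (fun y : E3 ↦ y + Y b) 0)).const_mul
    (2 * w (a, b))⁻¹
  refine h3.congr_of_eventuallyEq (Eventually.of_forall fun y ↦ ?_)
  simp only [Function.comp, add_sub_cancel_right]
  field_simp

end MovingOneCenter

theorem frequently_permLength_sub_ne_zero {Y : Fin N → E3} (hY : Y ∈ admissible N)
    {σ τ : Equiv.Perm (Fin N)} (h : ¬ SameEdges σ τ) :
    ∃ᶠ X in 𝓝 Y, permLength X σ - permLength X τ ≠ 0 := by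
  unfold SameEdges at h
  push Not at h
  obtain ⟨a, b, hab, hne⟩ := h
  have h1 := frequently_weighted_distances_ne_zero hY hab
    (fun q ↦ (edgeMult σ q.1 q.2 : ℝ) - edgeMult τ q.1 q.2)
    (fun i j ↦ by simp only [edgeMult_comm σ i, edgeMult_comm τ i])
    (sub_ne_zero.2 (by exact_mod_cast hne))
  refine h1.mono fun X hX h0 ↦ hX ?_
  simp only [sub_mul, Finset.sum_sub_distrib, ← two_mul_permLength]
  linarith

theorem volume_discriminant_zeros (N : ℕ) :
    volume {Y | Y ∈ admissible N ∧ discriminant N Y = 0} = 0 := by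
  have h1 : {Y | Y ∈ admissible N ∧ discriminant N Y = 0} ⊆
      ⋃ (σ : Equiv.Perm (Fin N)) (τ : Equiv.Perm (Fin N)) (_ : ¬ SameEdges σ τ),
        {Y | Y ∈ admissible N ∧ permLength Y σ - permLength Y τ = 0} := by
    rintro Y ⟨hY, h0⟩
    obtain ⟨σ, τ, hst, h2⟩ := discriminant_eq_zero_iff.1 h0
    simp only [Set.mem_iUnion]
    exact ⟨σ, τ, hst, hY, h2⟩
  refine measure_mono_null h1 (measure_iUnion_null fun σ ↦ measure_iUnion_null fun τ ↦
    measure_iUnion_null fun hst ↦ ?_)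
  exact measure_zeros_eq_zero_of_analyticOnNhd volume (isOpen_admissible N)
    ((analyticOnNhd_permLength σ).sub (analyticOnNhd_permLength τ))
    fun Y hY ↦ frequently_permLength_sub_ne_zero hY hst

theorem exists_discriminant_ne_zero (N : ℕ) : ∃ Y ∈ admissible N, discriminant N Y ≠ 0 := by
  by_contra! h
  refine ((isOpen_admissible N).measure_pos volume (admissible_nonempty N)).ne' ?_
  rw [← volume_discriminant_zeros N]
  congr 1
  ext Y
  exact ⟨fun hY ↦ ⟨hY, h Y hY⟩, fun hY ↦ hY.1⟩

theorem analyticOnNhd_discriminant (N : ℕ) :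
    AnalyticOnNhd ℝ (discriminant N) (admissible N) :=
  Finset.analyticOnNhd_fun_prod _ fun q _ ↦
    (analyticOnNhd_permLength q.1).sub (analyticOnNhd_permLength q.2)

end PointInteraction

theorem theorem3p2 (α : ℂ) (N : ℕ) :
    (∀ Y ∈ admissible N,
      Tendsto (fun R : ℝ => (resonanceCount α Y R : ℝ) / R) atTop (𝓝 (asymptoticDensity α Y)) ∧
        asymptoticDensity α Y ≤ PointInteraction.size Y / Real.pi) ∧
    (∃ S : Set (Fin N → E3),
      IsProperAnalyticSubset S (admissible N) ∧ nonWeylSet α N ⊆ S) ∧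
    volume (nonWeylSet α N) = 0 := by
  have hsub : nonWeylSet α N ⊆ {Y | Y ∈ admissible N ∧ discriminant N Y = 0} :=
    fun Y hY ↦ ⟨hY.1, discriminant_eq_zero_of_mem_nonWeylSet hY⟩
  refine ⟨fun Y hY ↦ ⟨?_, asymptoticDensity_le α hY⟩,
    ⟨_, ⟨isOpen_admissible N, discriminant N, analyticOnNhd_discriminant N,
      exists_discriminant_ne_zero N, rfl⟩, hsub⟩,
    measure_mono_null hsub (volume_discriminant_zeros N)⟩
  rw [asymptoticDensity_eq α hY]
  exact tendsto_resonanceCount_div α hY
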